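/- **Theorem.** An oriented virtual link diagram with $n$ ordered components, considered up to the virtual moves, is the same as a Gauss diagram on $n$ ordered oriented circles. Two such diagrams are *fused isotopic* if they are related by a finite sequence of Reidemeister moves, virtual moves and the two forbidden moves $F_o$, $F_u$ (which move a strand over, respectively under, a virtual crossing; on Gauss diagrams they transpose two consecutive overpasses, respectively two consecutive underpasses, and the virtual moves do nothing), respecting the orientations and the order of the components. A diagram is *classical* if, up to virtual moves, it can be drawn on the sphere without virtual crossings. For components $i\neq j$ the linking number $lk_{ij}$ is half the sum of the signs of the crossings between them. Let $n\ge 0$. 1. Two classical links with $n$ components are fused isotopic if and only if $lk_{ij}(L)=lk_{ij}(L')$ for all $1\le i<j\le n$. So, under fused isotopy, a classical link is completely determined by the linking numbers of its pairs of components. 2. Every classical link $L$ with $n$ components has integral linking numbers $lk_{ij}$, and it is fused isotopic to the closure of the pure braid $$\beta=x_2x_3\cdots x_n,\qquad x_k=A_{1,k}^{lk_{1k}}A_{2,k}^{lk_{2k}}\cdots A_{k-1,k}^{lk_{k-1,k}},$$ where $A_{i,j}=\sigma_{j-1}\cdots\sigma_{i+1}\,\sigma_i^{2}\,\sigma_{i+1}^{-1}\cdots\sigma_{j-1}^{-1}$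 for $i<j$, and the $i$-th component of $L$ corresponds to the closure of the $i$-th strand of $\beta$. -/

import Mathlib

open scoped List

/-- A passage of a strand through a classical crossing: the label of the crossing, and
`true` for the overpass (arrow tail), `false` for the underpass (arrow head). -/
abbrev Pass : Type := ℕ × Bool

/-- The other passage through the same crossing. -/
def Pass.flip (p : Pass) : Pass := (p.1, !p.2)

/-- An oriented virtual link diagram with `n` ordered components, recorded by its Gauss diagram:
for each component the cyclic sequence of classical crossings met while running once along it, with
over/under information, and the sign of each crossing. Each crossing has exactly one overpass and
one underpass. A component may be empty (a circle without classical crossings).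

Virtual crossings are not recorded: diagrams related by virtual moves have the same Gauss diagram,
and diagrams with the same Gauss diagram are related by virtual moves, so a Gauss diagram is a
virtual link diagram up to the virtual moves. The value of `sign` at unused labels is irrelevant. -/
structure GaussDiagram (n : ℕ) where
  crossings : Finset ℕ
  strand : Fin n → List Pass
  sign : ℕ → ℤˣ
  count_eq : ∀ p : Pass, ∑ i, (strand i).count p = if p.1 ∈ crossings then 1 else 0

namespace GaussDiagram

variable {n : ℕ}

/-! ### Fused isotopy -/

/-- `D'` is `D` with the crossings renamed and the base points of the components moved. -/
def Iso (D D' : GaussDiagram n) : Prop :=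
  ∃ f : Equiv.Perm ℕ,
    (∀ i, D'.strand i ~r (D.strand i).map (fun p => (f p.1, p.2))) ∧
    ∀ c ∈ D.crossings, D'.sign (f c) = D.sign c

/-- The passages `x ≠ y` are consecutive on a component, `y` coming directly after `x`. -/
def Adj (D : GaussDiagram n) (x y : Pass) : Prop :=
  ∃ i l, D.strand i ~r x :: y :: l

/-- `D'` is `D` with the crossings in `S` removed. -/
def IsDeletion (S : Finset ℕ) (D D' : GaussDiagram n) : Prop :=
  (∀ i, D'.strand i ~r (D.strand i).filter (fun p => p.1 ∉ S)) ∧ D'.sign = D.sign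

/-- `D'` is `D` with the consecutive passages `x`, `y` transposed. -/
def SwapAt (x y : Pass) (D D' : GaussDiagram n) : Prop :=
  (∃ i l, D.strand i ~r x :: y :: l ∧ D'.strand i ~r y :: x :: l ∧
    ∀ j, j ≠ i → D'.strand j ~r D.strand j) ∧ D'.sign = D.sign

/-- Transposition of the neighbours `x`, `y`, which in `D` come in the order `x`, `y` if `δ = 1` and
in the order `y`, `x` if `δ = -1`. -/
def OrientedSwap (δ : ℤˣ) (x y : Pass) (D D' : GaussDiagram n) : Prop :=
  if δ = 1 then SwapAt x y D D' else SwapAt y x D D'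

/-- First Reidemeister move (removal of a curl of either type and either sign). -/
def R1 (D D' : GaussDiagram n) : Prop :=
  ∃ (c : ℕ) (b : Bool), D.Adj (c, b) (c, !b) ∧ IsDeletion {c} D D'

/-- Second Reidemeister move (removal of a bigon). The two arcs of the bigon may run in parallel or
in opposite directions; the two crossings have opposite signs. -/
def R2 (D D' : GaussDiagram n) : Prop :=
  ∃ a b : ℕ, a ≠ b ∧ D.sign a = - D.sign b ∧ D.Adj (a, true) (b, true) ∧
    (D.Adj (a, false) (b, false) ∨ D.Adj (b, false) (a, false)) ∧ IsDeletion {a, b} D D'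

/-- Third Reidemeister move. In a triangle formed by a top, a middle and a bottom strand let `p` be
the crossing top/middle, `q` the crossing top/bottom and `r` the crossing middle/bottom, and let
`δt`, `δm`, `δb` say in which order each strand meets its two crossings. For three oriented lines in
the plane, the product of the sign of a crossing and the order on the opposite strand is the same for
all three crossings (`s` below); this describes all oriented versions of the move. The move reverses
the order of the two crossings on each of the three strands. -/
def R3 (D D' : GaussDiagram n) : Prop :=
  ∃ (p q r : ℕ) (δt δm δb s : ℤˣ), p ≠ q ∧ p ≠ r ∧ q ≠ r ∧
    D.sign p = s * δb ∧ D.sign q = s * δm ∧ D.sign r = s * δt ∧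
    ∃ D₁ D₂ : GaussDiagram n,
      OrientedSwap δt (p, true) (q, true) D D₁ ∧
      OrientedSwap δm (p, false) (r, true) D₁ D₂ ∧
      OrientedSwap δb (q, false) (r, false) D₂ D'

/-- The forbidden move `F_o`: a strand running over two others is moved across their virtual
crossing, so that its two consecutive overpasses are transposed. -/
def Fo (D D' : GaussDiagram n) : Prop :=
  ∃ a b : ℕ, SwapAt (a, true) (b, true) D D'

/-- The forbidden move `F_u`: a strand running under two others is moved across their virtual
crossing, so that its two consecutive underpasses are transposed. -/
def Fu (D D' : GaussDiagram n) : Prop :=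
  ∃ a b : ℕ, SwapAt (a, false) (b, false) D D'

/-- One step of a fused isotopy. -/
def FusedMove (D D' : GaussDiagram n) : Prop :=
  Iso D D' ∨ R1 D D' ∨ R2 D D' ∨ R3 D D' ∨ Fo D D' ∨ Fu D D'

/-- Fused isotopy (of links with ordered, oriented components): the equivalence relation generated
by the Reidemeister moves and the two forbidden moves. -/
def FusedIsotopic (D D' : GaussDiagram n) : Prop :=
  Relation.EqvGen FusedMove D D'

/-! ### Classical diagrams

The Gauss diagram determines a 4-valent graph, with the crossings as vertices and the segments
between consecutive passages as edges, together with a cyclic order of the half-edges at each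
vertex, hence a cellular embedding in a closed oriented surface. The diagram can be drawn on the
sphere without virtual crossings exactly if that surface consists of spheres. -/

/-- `y` is the first passage after `x` on its component (`y = x` if there is no other). -/
def Next (D : GaussDiagram n) (x y : Pass) : Prop :=
  ∃ i, (D.strand i = [x] ∧ y = x) ∨ ∃ l, D.strand i ~r x :: y :: l

/-- `1` if, for someone running through the passage `p`, the other strand at that crossing runs from
right to left, `-1` if it runs from left to right. -/
def turn (D : GaussDiagram n) (p : Pass) : ℤˣ :=
  if p.2 then D.sign p.1 else - D.sign p.1

/-- Half-edges: `(p, 1)` leaves the passage `p` forwards, `(p, -1)` leaves it backwards. -/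
abbrev Dart (D : GaussDiagram n) : Type := {x : Pass × ℤˣ // x.1.1 ∈ D.crossings}

/-- Following an edge to its other end and turning left there, one runs along the boundary of the
face on the left. -/
def FaceStep (D : GaussDiagram n) (x y : D.Dart) : Prop :=
  ∃ q : Pass,
    ((x.1.2 = 1 ∧ D.Next x.1.1 q) ∨ (x.1.2 = -1 ∧ D.Next q x.1.1)) ∧
    y.1 = (q.flip, x.1.2 * D.turn q)

/-- The faces: the cyclic sequences of half-edges obtained by repeating `FaceStep`. -/
def Face (D : GaussDiagram n) : Type := Quot D.FaceStep

/-- Two crossings are joined by an edge. -/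
def Joined (D : GaussDiagram n) (c d : {c : ℕ // c ∈ D.crossings}) : Prop :=
  ∃ a b : Bool, D.Next (c.1, a) (d.1, b)

/-- The connected pieces of the underlying 4-valent graph. -/
def Piece (D : GaussDiagram n) : Type := Quot D.Joined

/-- The diagram is classical (it can be drawn on the sphere without virtual crossings): its surface
has Euler characteristic `V - E + F = 2 C`, where `E = 2 V` as the graph is 4-valent and `C` is the
number of connected pieces. Circles without crossings play no role. -/
def IsClassical (D : GaussDiagram n) : Prop :=
  (D.crossings.card : ℤ) - 2 * D.crossings.card + Nat.card D.Face = 2 * Nat.card D.Piece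

/-! ### Linking numbers -/

/-- The linking number of two distinct components: half the sum of the signs of the crossings
between them. -/
def lk (D : GaussDiagram n) (i j : Fin n) : ℚ :=
  (∑ c ∈ D.crossings with
      ((c, true) ∈ D.strand i ∧ (c, false) ∈ D.strand j) ∨
      ((c, true) ∈ D.strand j ∧ (c, false) ∈ D.strand i),
    ((D.sign c : ℤ) : ℚ)) / 2

end GaussDiagram

/-! ### Braid words and closures of pure braids -/

/-- A word in the generators `σ_i` (`(i, true)`) and their inverses (`(i, false)`). The generator
`σ_i` crosses the strands in the positions `i` and `i + 1`; positions are counted from `0`. -/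
abbrev BraidWord : Type := List (ℕ × Bool)

namespace BraidWord

/-- The inverse word. -/
def inv (w : BraidWord) : BraidWord := (w.map fun x => (x.1, !x.2)).reverse

/-- Integral powers of a word. -/
def pow (w : BraidWord) (m : ℤ) : BraidWord :=
  (List.replicate m.natAbs (if 0 ≤ m then w else inv w)).flatten

/-- `σ_{j-1} σ_{j-2} ⋯ σ_{i+1}`. -/
def descending (i j : ℕ) : BraidWord :=
  ((List.range' (i + 1) (j - 1 - i)).map fun m => (m, true)).reverse

/-- The pure braid generator
`A_{i,j} = σ_{j-1} ⋯ σ_{i+1} σ_i² σ_{i+1}⁻¹ ⋯ σ_{j-1}⁻¹`, for `i < j`. -/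
def pureGen (i j : ℕ) : BraidWord :=
  descending i j ++ [(i, true), (i, true)] ++ inv (descending i j)

/-- The factor `A_{0,j}^{k_{0,j}} A_{1,j}^{k_{1,j}} ⋯ A_{j-1,j}^{k_{j-1,j}}`. -/
def factor {n : ℕ} (k : Fin n → Fin n → ℤ) (j : Fin n) : BraidWord :=
  ((List.finRange n).filter fun i : Fin n => i < j).flatMap fun i : Fin n => pow (pureGen i j) (k i j)

/-- The product of all these factors, in the order of increasing `j` (the one for `j = 0` is
empty). -/
def standard {n : ℕ} (k : Fin n → Fin n → ℤ) : BraidWord :=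
  (List.finRange n).flatMap (factor k)

/-- The passages met by the strand which starts in position `p`, when the crossings are numbered
consecutively from `t`. In the positive crossing `σ_i` the strand going from position `i` to
position `i + 1` is the overstrand, in `σ_i⁻¹` it is the understrand. -/
def trace : BraidWord → ℕ → ℕ → List Pass
  | [], _, _ => []
  | (i, e) :: w, t, p =>
    if p = i then (t, e) :: trace w (t + 1) (i + 1)
    else if p = i + 1 then (t, !e) :: trace w (t + 1) i
    else trace w (t + 1) p

/-- The position in which the strand starting in position `p` ends. -/
def endpoint : BraidWord → ℕ → ℕ
  | [], p => p
  | (i, _) :: w, p =>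
    if p = i then endpoint w (i + 1)
    else if p = i + 1 then endpoint w i
    else endpoint w p

end BraidWord

/-- `w` is a pure braid word on `n` strands, and `B` is the diagram of its closure; the component
`i` is the closure of the strand `i`. -/
def GaussDiagram.IsPureBraidClosure {n : ℕ} (B : GaussDiagram n) (w : BraidWord) : Prop :=
  (∀ x ∈ w, x.1 + 1 < n) ∧
  (∀ i : Fin n, w.endpoint i = i) ∧
  (∀ i : Fin n, B.strand i = w.trace 0 i) ∧
  ∀ (t : ℕ) (h : t < w.length), B.sign t = if w[t].2 then 1 else -1

/-!
The proof goes through the ordered linking numbers `vlk i j`: the sum of the signs of the crossings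
at which the component `i` passes over the component `j`. It has three parts.

*The ordered linking numbers classify all virtual link diagrams up to fused isotopy*
(`fusedIsotopic_iff_vlk`). Invariance is a check of the moves. Conversely, any two consecutive
passages can be transposed (`SwapAt.fusedIsotopic`): two overpasses or two underpasses by a forbidden
move, the two passages of one crossing by removing a curl and putting it back the other way, and the
underpass of `p` and the overpass of `r` by creating a pair of crossings `q`, `q'` between the top
strand at `p` and the bottom strand at `r` with a second Reidemeister move, performing a third
Reidemeister move on the triangle `p`, `q`, `r`, restoring the order on its top and bottom strands
with forbidden moves, and removing `q`, `q'` again. So the order of the passages on the components is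
immaterial, crossings of a component with itself and pairs of crossings of opposite signs can be
removed, and what is left is determined by the numbers `vlk i j`.

*In a classical diagram `vlk i j = vlk j i`* (`IsClassical.vlk_comm`), so that both are equal to
`lk i j`. This is the vanishing of the intersection number of two closed curves on a sphere. With
rational coefficients, the coboundaries of functions on the crossings and the jumps of functions on
the faces are orthogonal subspaces of the space of functions on the edges, and the condition on the
Euler characteristic says that their dimensions add up to the number of edges. A function which is
constant along the components is orthogonal to the former, hence is the jump of a function on the
faces. For the indicator function of the component `j`, this function on the faces changes by a sign
whenever the component `i` crosses the component `j`, and the changes along the closed curve `i` add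
up to zero.

*In the closure of the standard braid, `vlk i j = vlk j i = k i j` for `i < j`* (`overSum_standard`).
The sum of the signs of the crossings of one strand over another is additive for pure braids, vanishes
for conjugating words against their inverses, and is `1` in both orders for the strands `i` and `j`
of `A_{i,j}`.
-/

/-! ### Rotations of lists -/

namespace List

variable {α β : Type*} {l l' : List α}

theorem isRotated_of_eq (h : l = l') : l ~r l' := h ▸ IsRotated.refl l

theorem IsRotated.exists_append (h : l ~r l') : ∃ a b, l = a ++ b ∧ l' = b ++ a := by
  obtain ⟨k, hk, rfl⟩ := isRotated_iff_mod.1 h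
  exact ⟨l.take k, l.drop k, (take_append_drop k l).symm, rotate_eq_drop_append_take hk⟩

theorem IsRotated.filter_of (h : l ~r l') (p : α → Bool) : l.filter p ~r l'.filter p := by
  obtain ⟨a, b, rfl, rfl⟩ := h.exists_append
  simpa using isRotated_append

theorem IsRotated.flatMap_of (h : l ~r l') (f : α → List β) : l.flatMap f ~r l'.flatMap f := by
  obtain ⟨a, b, rfl, rfl⟩ := h.exists_append
  simpa using isRotated_append

theorem exists_isRotated_cons {x : α} (h : x ∈ l) : ∃ m, l ~r x :: m := by
  obtain ⟨a, b, rfl⟩ := append_of_mem h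
  exact ⟨b ++ a, isRotated_append⟩

end List

namespace GaussDiagram

variable {n : ℕ}

/-! ### Passages and strands -/

section Basic

variable (D : GaussDiagram n)

theorem mem_crossings_iff (p : Pass) : p.1 ∈ D.crossings ↔ ∃ i, p ∈ D.strand i := by
  have h := D.count_eq p
  constructor
  · intro hp
    by_contra! hn
    rw [if_pos hp, Finset.sum_eq_zero fun i _ => List.count_eq_zero.2 (hn i)] at h
    exact zero_ne_one h
  · rintro ⟨i, hi⟩
    by_contra hp
    rw [if_neg hp] at h
    exact List.count_eq_zero.1 ((Finset.sum_eq_zero_iff.1 h) i (Finset.mem_univ i)) hi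

variable {D} in
theorem mem_crossings_of_mem {p : Pass} {i : Fin n} (h : p ∈ D.strand i) : p.1 ∈ D.crossings :=
  (D.mem_crossings_iff p).2 ⟨i, h⟩

theorem count_le_one (p : Pass) : ∑ i, (D.strand i).count p ≤ 1 := by
  rw [D.count_eq p]; split_ifs <;> simp

theorem nodup_strand (i : Fin n) : (D.strand i).Nodup :=
  List.nodup_iff_count_le_one.2 fun p =>
    (Finset.single_le_sum (f := fun i => (D.strand i).count p) (fun _ _ => Nat.zero_le _)
      (Finset.mem_univ i)).trans (D.count_le_one p)

variable {D} in
theorem strand_unique {p : Pass} {i j : Fin n} (hi : p ∈ D.strand i) (hj : p ∈ D.strand j) :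
    i = j := by
  by_contra hij
  have h1 := List.count_pos_iff.2 hi
  have h2 := List.count_pos_iff.2 hj
  have h3 := D.count_le_one p
  have h4 : ∑ k ∈ {i, j}, (D.strand k).count p ≤ ∑ k, (D.strand k).count p :=
    Finset.sum_le_sum_of_subset (Finset.subset_univ _)
  rw [Finset.sum_pair hij] at h4
  omega

/-- A Gauss diagram from its strands, when no passage occurs twice. -/
def ofNodup (crossings : Finset ℕ) (strand : Fin n → List Pass) (sign : ℕ → ℤˣ)
    (nodup : ∀ i, (strand i).Nodup)
    (unique : ∀ p i j, p ∈ strand i → p ∈ strand j → i = j)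
    (mem : ∀ p : Pass, p.1 ∈ crossings ↔ ∃ i, p ∈ strand i) : GaussDiagram n where
  crossings := crossings
  strand := strand
  sign := sign
  count_eq p := by
    split_ifs with h
    · obtain ⟨i, hi⟩ := (mem p).1 h
      rw [Finset.sum_eq_single i, List.count_eq_one_of_mem (nodup i) hi]
      · intro j _ hj
        exact List.count_eq_zero.2 fun h' => hj (unique p _ _ h' hi)
      · simp
    · refine Finset.sum_eq_zero fun i _ => List.count_eq_zero.2 fun hi => h ((mem p).2 ⟨i, hi⟩)

/-- The diagram `D` with the passages on each component rearranged. -/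
def withStrand (s : Fin n → List Pass) (hs : ∀ i, s i ~ D.strand i) : GaussDiagram n where
  crossings := D.crossings
  strand := s
  sign := D.sign
  count_eq p := by
    rw [← D.count_eq p]
    exact Finset.sum_congr rfl fun i _ => (hs i).count_eq p

/-- The diagram `D` with the crossings in `S` removed. -/
def delete (S : Finset ℕ) : GaussDiagram n :=
  ofNodup (D.crossings \ S) (fun i => (D.strand i).filter fun p => p.1 ∉ S) D.sign
    (fun i => (D.nodup_strand i).filter _)
    (fun p i j hi hj => strand_unique (List.mem_of_mem_filter hi) (List.mem_of_mem_filter hj))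
    (fun p => by
      simp only [Finset.mem_sdiff, D.mem_crossings_iff p, List.mem_filter, decide_eq_true_eq,
        exists_and_right])

theorem isDeletion_delete (S : Finset ℕ) : IsDeletion S D (D.delete S) :=
  ⟨fun _ => List.IsRotated.refl _, rfl⟩

end Basic

/-! ### Ordered linking numbers -/

/-- The ordered (or virtual) linking number: the sum of the signs of the crossings at which the
component `i` passes over the component `j`. -/
def vlk (D : GaussDiagram n) (i j : Fin n) : ℤ :=
  ∑ c ∈ D.crossings with (c, true) ∈ D.strand i ∧ (c, false) ∈ D.strand j, (D.sign c : ℤ)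

theorem lk_eq (D : GaussDiagram n) {i j : Fin n} (h : i ≠ j) :
    D.lk i j = (D.vlk i j + D.vlk j i) / 2 := by
  unfold lk vlk
  rw [Finset.filter_or, Finset.sum_union]
  · push_cast; rfl
  · rw [Finset.disjoint_filter]
    rintro c _ ⟨h1, _⟩ ⟨h2, _⟩
    exact h (strand_unique h1 h2)

theorem vlk_eq_of_mem_iff {D D' : GaussDiagram n} (h : ∀ i p, p ∈ D'.strand i ↔ p ∈ D.strand i)
    (hs : D'.sign = D.sign) (i j : Fin n) : D'.vlk i j = D.vlk i j := by
  have hc : D'.crossings = D.crossings := by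
    ext c
    rw [D.mem_crossings_iff (c, true), D'.mem_crossings_iff (c, true)]
    simp only [h]
  unfold vlk
  simp only [hc, h, hs]

theorem SwapAt.mem_iff {x y : Pass} {D D' : GaussDiagram n} (h : SwapAt x y D D') (i : Fin n)
    (p : Pass) : p ∈ D'.strand i ↔ p ∈ D.strand i := by
  obtain ⟨⟨j, l, h1, h2, h3⟩, -⟩ := h
  by_cases hij : i = j
  · subst hij
    rw [h1.mem_iff, h2.mem_iff]
    simp only [List.mem_cons]
    tauto
  · exact (h3 i hij).mem_iff

theorem SwapAt.symm {x y : Pass} {D D' : GaussDiagram n} (h : SwapAt x y D D') :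
    SwapAt y x D' D := by
  obtain ⟨⟨j, l, h1, h2, h3⟩, h4⟩ := h
  exact ⟨⟨j, l, h2, h1, fun k hk => (h3 k hk).symm⟩, h4.symm⟩

theorem SwapAt.vlk_eq {x y : Pass} {D D' : GaussDiagram n} (h : SwapAt x y D D') (i j : Fin n) :
    D'.vlk i j = D.vlk i j :=
  vlk_eq_of_mem_iff h.mem_iff h.2 i j

theorem OrientedSwap.vlk_eq {δ : ℤˣ} {x y : Pass} {D D' : GaussDiagram n}
    (h : OrientedSwap δ x y D D') (i j : Fin n) : D'.vlk i j = D.vlk i j := by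
  unfold OrientedSwap at h
  split_ifs at h <;> exact h.vlk_eq i j

theorem Iso.vlk_eq {D D' : GaussDiagram n} (h : Iso D D') (i j : Fin n) :
    D'.vlk i j = D.vlk i j := by
  obtain ⟨f, h1, h2⟩ := h
  have hm : ∀ i c b, (f c, b) ∈ D'.strand i ↔ (c, b) ∈ D.strand i := by
    intro i c b
    rw [(h1 i).mem_iff]
    simp
  have hc : ∀ c, f c ∈ D'.crossings ↔ c ∈ D.crossings := by
    intro c
    rw [D.mem_crossings_iff (c, true), D'.mem_crossings_iff (f c, true)]
    simp only [hm]
  unfold vlk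
  symm
  refine Finset.sum_equiv f ?_ ?_
  · intro c
    simp only [Finset.mem_filter, hm, hc]
  · intro c hc'
    rw [h2 c (Finset.mem_filter.1 hc').1]

theorem IsDeletion.mem_iff {S : Finset ℕ} {D D' : GaussDiagram n} (h : IsDeletion S D D')
    (i : Fin n) (p : Pass) : p ∈ D'.strand i ↔ p ∈ D.strand i ∧ p.1 ∉ S := by
  rw [(h.1 i).mem_iff]
  simp

theorem IsDeletion.mem_crossings {S : Finset ℕ} {D D' : GaussDiagram n} (h : IsDeletion S D D')
    (c : ℕ) : c ∈ D'.crossings ↔ c ∈ D.crossings ∧ c ∉ S := by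
  rw [D.mem_crossings_iff (c, true), D'.mem_crossings_iff (c, true)]
  simp [h.mem_iff]

/-- A deletion does not change the ordered linking number if the signs of the removed crossings
between the two components add up to zero. -/
theorem IsDeletion.vlk_eq {S : Finset ℕ} {D D' : GaussDiagram n} (h : IsDeletion S D D')
    {i j : Fin n}
    (h0 : ∑ c ∈ S with (c, true) ∈ D.strand i ∧ (c, false) ∈ D.strand j, (D.sign c : ℤ) = 0) :
    D'.vlk i j = D.vlk i j := by
  unfold vlk
  rw [← Finset.sum_filter_add_sum_filter_not
    (D.crossings.filter fun c => (c, true) ∈ D.strand i ∧ (c, false) ∈ D.strand j) (· ∈ S),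
    h.2]
  have e1 : ((D.crossings.filter fun c => (c, true) ∈ D.strand i ∧ (c, false) ∈ D.strand j).filter
      (· ∈ S)) = S.filter fun c => (c, true) ∈ D.strand i ∧ (c, false) ∈ D.strand j := by
    ext c
    simp only [Finset.mem_filter]
    constructor
    · tauto
    · rintro ⟨h1, h2, h3⟩
      exact ⟨⟨mem_crossings_of_mem h2, h2, h3⟩, h1⟩
  rw [e1, h0, zero_add]
  refine Finset.sum_congr ?_ fun _ _ => rfl
  ext c
  simp only [Finset.mem_filter, h.mem_crossings, h.mem_iff]
  tauto

theorem Adj.same_strand {D : GaussDiagram n} {x y : Pass} (h : D.Adj x y) (i : Fin n) :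
    x ∈ D.strand i ↔ y ∈ D.strand i := by
  obtain ⟨j, l, hl⟩ := h
  have hx : x ∈ D.strand j := hl.mem_iff.2 (by simp)
  have hy : y ∈ D.strand j := hl.mem_iff.2 (by simp)
  constructor <;> intro h'
  · rwa [strand_unique h' hx]
  · rwa [strand_unique h' hy]

theorem FusedMove.vlk_eq {D D' : GaussDiagram n} (h : FusedMove D D') {i j : Fin n} (hij : i ≠ j) :
    D'.vlk i j = D.vlk i j := by
  rcases h with h | ⟨c, b, ha, hd⟩ | ⟨a, b, hab, hs, ha, hb, hd⟩ |
    ⟨p, q, r, _, _, _, _, _, _, _, _, _, _, D₁, D₂, h1, h2, h3⟩ | ⟨a, b, h⟩ | ⟨a, b, h⟩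
  · exact h.vlk_eq i j
  · refine hd.vlk_eq (Finset.sum_eq_zero fun d hdc => ?_)
    exfalso
    simp only [Finset.mem_filter, Finset.mem_singleton] at hdc
    obtain ⟨rfl, h1, h2⟩ := hdc
    cases b
    · exact hij (strand_unique h1 ((ha.same_strand j).1 h2))
    · exact hij (strand_unique ((ha.same_strand i).1 h1) h2)
  · refine hd.vlk_eq ?_
    have hb' : (a, false) ∈ D.strand j ↔ (b, false) ∈ D.strand j :=
      hb.elim (fun h => h.same_strand j) fun h => (h.same_strand j).symm
    rw [Finset.sum_filter, Finset.sum_pair hab]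
    simp only [ha.same_strand i, hb', hs]
    split_ifs <;> simp
  · rw [h3.vlk_eq, h2.vlk_eq, h1.vlk_eq]
  · exact h.vlk_eq i j
  · exact h.vlk_eq i j

theorem FusedIsotopic.vlk_eq {D D' : GaussDiagram n} (h : FusedIsotopic D D') {i j : Fin n}
    (hij : i ≠ j) : D'.vlk i j = D.vlk i j := by
  induction h with
  | rel _ _ h => exact h.vlk_eq hij
  | refl => rfl
  | symm _ _ _ ih => exact ih.symm
  | trans _ _ _ _ _ ih1 ih2 => exact ih2.trans ih1

/-! ### Rearranging the passages on a component -/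

/-- The diagram `D` with other signs. -/
def setSign (D : GaussDiagram n) (σ : ℕ → ℤˣ) : GaussDiagram n := { D with sign := σ }

theorem FusedMove.fusedIsotopic {D D' : GaussDiagram n} (h : FusedMove D D') :
    FusedIsotopic D D' :=
  Relation.EqvGen.rel _ _ h

theorem FusedIsotopic.symm {D D' : GaussDiagram n} (h : FusedIsotopic D D') :
    FusedIsotopic D' D :=
  Relation.EqvGen.symm _ _ h

theorem FusedIsotopic.trans {D D' D'' : GaussDiagram n} (h : FusedIsotopic D D')
    (h' : FusedIsotopic D' D'') : FusedIsotopic D D'' :=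
  Relation.EqvGen.trans _ _ _ h h'

theorem fusedIsotopic_of_isRotated {D D' : GaussDiagram n} (h : ∀ i, D'.strand i ~r D.strand i)
    (hs : ∀ c ∈ D.crossings, D'.sign c = D.sign c) : FusedIsotopic D D' :=
  FusedMove.fusedIsotopic (Or.inl ⟨1, by simpa using h, hs⟩)

theorem fusedIsotopic_setSign (D : GaussDiagram n) {σ : ℕ → ℤˣ}
    (hs : ∀ c ∈ D.crossings, σ c = D.sign c) : FusedIsotopic D (D.setSign σ) :=
  fusedIsotopic_of_isRotated (fun _ => List.IsRotated.refl _) hs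

/-- The passage `x`, followed by passages of the same kind through two new crossings `q` and `q'` if
`x` is the overpass of `p` or the underpass of `r`. -/
def doubled (p r q q' : ℕ) (x : Pass) : List Pass :=
  x :: if x = (p, true) ∨ x = (r, false) then [(q, x.2), (q', x.2)] else []

theorem mem_doubled {p r q q' : ℕ} {x z : Pass} : z ∈ doubled p r q q' x ↔
    z = x ∨ (x = (p, true) ∨ x = (r, false)) ∧ (z = (q, x.2) ∨ z = (q', x.2)) := by
  unfold doubled
  split_ifs with h <;> simp [h]

/-- The crossings `p` and `r` belong to `D`, and `q`, `q'` are two labels not used in `D`. -/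
structure Insertable (D : GaussDiagram n) (p r q q' : ℕ) : Prop where
  mem_left : p ∈ D.crossings
  mem_right : r ∈ D.crossings
  notMem : q ∉ D.crossings
  notMem' : q' ∉ D.crossings
  ne : q ≠ q'

namespace Insertable

variable {D : GaussDiagram n} {p r q q' : ℕ} (h : D.Insertable p r q q')
include h

theorem nodup_doubled {x : Pass} (hx : x.1 ∈ D.crossings) : (doubled p r q q' x).Nodup := by
  have h1 : x ≠ (q, x.2) := fun e => h.notMem (by rw [e] at hx; exact hx)
  have h2 : x ≠ (q', x.2) := fun e => h.notMem' (by rw [e] at hx; exact hx)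
  have h3 : (q, x.2) ≠ (q', x.2) := fun e => h.ne (congrArg Prod.fst e)
  unfold doubled
  split_ifs <;> simp [h1, h2, h.ne]

theorem eq_of_mem_doubled {x y z : Pass} (hx : x.1 ∈ D.crossings) (hy : y.1 ∈ D.crossings)
    (hzx : z ∈ doubled p r q q' x) (hzy : z ∈ doubled p r q q' y) : x = y := by
  have := h.notMem
  have := h.notMem'
  rw [mem_doubled] at hzx hzy
  rcases hzx with rfl | ⟨rfl | rfl, rfl | rfl⟩ <;> rcases hzy with e | ⟨rfl | rfl, e | e⟩ <;>
    first
    | exact e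
    | rfl
    | (subst e; simp_all)
    | simp_all

theorem filter_doubled {x : Pass} (hx : x.1 ∈ D.crossings) :
    (doubled p r q q' x).filter (fun z => z.1 ∉ ({q, q'} : Finset ℕ)) = [x] := by
  have h1 : x.1 ≠ q := fun e => h.notMem (e ▸ hx)
  have h2 : x.1 ≠ q' := fun e => h.notMem' (e ▸ hx)
  unfold doubled
  split_ifs <;> simp [h1, h2]

end Insertable

/-- The diagram `D` with two new crossings `q` and `q'`: their overpasses are inserted next to the
overpass of `p`, their underpasses next to the underpass of `r`, in the order given by `f`. -/
def insertPair (D : GaussDiagram n) {p r q q' : ℕ} (h : D.Insertable p r q q')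
    (f : Pass → List Pass) (hf : ∀ x, f x ~ doubled p r q q' x) : GaussDiagram n :=
  ofNodup (insert q (insert q' D.crossings)) (fun i => (D.strand i).flatMap f) D.sign
    (fun i => List.nodup_flatMap.2 ⟨fun x hx =>
      (hf x).nodup_iff.2 (h.nodup_doubled (mem_crossings_of_mem hx)),
      (D.nodup_strand i).pairwise_of_forall_ne fun x hx y hy hxy z hzx hzy =>
        hxy (h.eq_of_mem_doubled (mem_crossings_of_mem hx) (mem_crossings_of_mem hy)
          ((hf x).mem_iff.1 hzx) ((hf y).mem_iff.1 hzy))⟩)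
    (fun z i j hi hj => by
      obtain ⟨x, hx, hzx⟩ := List.mem_flatMap.1 hi
      obtain ⟨y, hy, hzy⟩ := List.mem_flatMap.1 hj
      obtain rfl := h.eq_of_mem_doubled (mem_crossings_of_mem hx) (mem_crossings_of_mem hy)
          ((hf x).mem_iff.1 hzx) ((hf y).mem_iff.1 hzy)
      exact strand_unique hx hy)
    (fun z => by
      simp only [Finset.mem_insert, List.mem_flatMap, (hf _).mem_iff]
      obtain ⟨i, hi⟩ := (D.mem_crossings_iff (p, true)).1 h.mem_left
      obtain ⟨j, hj⟩ := (D.mem_crossings_iff (r, false)).1 h.mem_right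
      constructor
      · rintro (hz | hz | hz)
        · obtain ⟨c, b⟩ := z
          obtain rfl : c = q := hz
          cases b
          · exact ⟨j, _, hj, mem_doubled.2 (by simp)⟩
          · exact ⟨i, _, hi, mem_doubled.2 (by simp)⟩
        · obtain ⟨c, b⟩ := z
          obtain rfl : c = q' := hz
          cases b
          · exact ⟨j, _, hj, mem_doubled.2 (by simp)⟩
          · exact ⟨i, _, hi, mem_doubled.2 (by simp)⟩
        · obtain ⟨k, hk⟩ := (D.mem_crossings_iff z).1 hz
          exact ⟨k, z, hk, mem_doubled.2 (Or.inl rfl)⟩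
      · rintro ⟨k, x, hx, hzx⟩
        rcases mem_doubled.1 hzx with rfl | ⟨-, rfl | rfl⟩
        · exact Or.inr (Or.inr (mem_crossings_of_mem hx))
        · exact Or.inl rfl
        · exact Or.inr (Or.inl rfl))

section InsertPair

variable {D D' : GaussDiagram n} {p r q q' : ℕ} (h : D.Insertable p r q q')
  {f : Pass → List Pass} (hf : ∀ x, f x ~ doubled p r q q' x)

theorem isDeletion_insertPair : IsDeletion {q, q'} (D.insertPair h f hf) D := by
  refine ⟨fun i => ?_, rfl⟩
  have e : ((D.strand i).flatMap f).filter (fun z => z.1 ∉ ({q, q'} : Finset ℕ)) = D.strand i := by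
    rw [List.filter_flatMap]
    conv_rhs => rw [← List.flatMap_singleton' (D.strand i)]
    refine List.flatMap_congr fun x hx => ?_
    rw [← List.perm_singleton, ← h.filter_doubled (mem_crossings_of_mem hx)]
    exact (hf x).filter _
  change D.strand i ~r ((D.strand i).flatMap f).filter (fun z => z.1 ∉ ({q, q'} : Finset ℕ))
  rw [e]

/-- Two neighbours inside one of the blocks `f z` can be transposed by changing `f` at `z`. -/
theorem swapAt_insertPair {f' : Pass → List Pass} (hf' : ∀ x, f' x ~ doubled p r q q' x) {z : Pass}
    (hz : z.1 ∈ D.crossings) (hff' : ∀ x, x ≠ z → f' x = f x) {x y : Pass} {A B : List Pass}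
    (hfz : f z = A ++ x :: y :: B) (hfz' : f' z = A ++ y :: x :: B) :
    SwapAt x y (D.insertPair h f hf) (D.insertPair h f' hf') := by
  obtain ⟨i, hi⟩ := (D.mem_crossings_iff z).1 hz
  obtain ⟨m, hm⟩ := List.exists_isRotated_cons hi
  have hzm : z ∉ m := (List.nodup_cons.1 (hm.nodup_iff.1 (D.nodup_strand i))).1
  have hmm : m.flatMap f' = m.flatMap f :=
    List.flatMap_congr fun w hw => hff' w fun e => hzm (e ▸ hw)
  refine ⟨⟨i, B ++ m.flatMap f ++ A, ?_, ?_, ?_⟩, rfl⟩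
  · refine (hm.flatMap_of f).trans ?_
    rw [List.flatMap_cons, hfz, List.append_assoc]
    exact List.isRotated_append.trans (by simp [List.IsRotated.refl])
  · refine (hm.flatMap_of f').trans ?_
    rw [List.flatMap_cons, hfz', hmm, List.append_assoc]
    exact List.isRotated_append.trans (by simp [List.IsRotated.refl])
  · intro j hj
    change (D.strand j).flatMap f' ~r (D.strand j).flatMap f
    rw [List.flatMap_congr fun w hw => hff' w fun e => hj (strand_unique hw (e ▸ hi))]

theorem adj_insertPair {z : Pass} (hz : z.1 ∈ D.crossings) {x y : Pass} {A B : List Pass}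
    (hfz : f z = A ++ x :: y :: B) : (D.insertPair h f hf).Adj x y := by
  obtain ⟨i, hi⟩ := (D.mem_crossings_iff z).1 hz
  obtain ⟨m, hm⟩ := List.exists_isRotated_cons hi
  refine ⟨i, B ++ m.flatMap f ++ A, (hm.flatMap_of f).trans ?_⟩
  rw [List.flatMap_cons, hfz, List.append_assoc]
  exact List.isRotated_append.trans (by simp [List.IsRotated.refl])

theorem SwapAt.insertPair {x y : Pass} (hs : SwapAt x y D D') (h' : D'.Insertable p r q q')
    (hx : f x = [x]) (hy : f y = [y]) :
    SwapAt x y (D.insertPair h f hf) (D'.insertPair h' f hf) := by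
  obtain ⟨⟨i, l, h1, h2, h3⟩, h4⟩ := hs
  refine ⟨⟨i, l.flatMap f, ?_, ?_, fun j hj => (h3 j hj).flatMap_of f⟩, h4⟩
  · have := h1.flatMap_of f
    simp only [List.flatMap_cons, hx, hy] at this
    exact this
  · have := h2.flatMap_of f
    simp only [List.flatMap_cons, hx, hy] at this
    exact this

end InsertPair

theorem SwapAt.mem_crossings {x y : Pass} {D D' : GaussDiagram n} (h : SwapAt x y D D') (c : ℕ) :
    c ∈ D'.crossings ↔ c ∈ D.crossings := by
  rw [D.mem_crossings_iff (c, true), D'.mem_crossings_iff (c, true)]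
  simp only [h.mem_iff]

/-- The passages around the overpass of `p` and the underpass of `r`, given by lists `u` and `v`. -/
def blocks (p r : ℕ) (u v : List Pass) (x : Pass) : List Pass :=
  if x = (p, true) then u else if x = (r, false) then v else [x]

theorem blocks_perm {p r q q' : ℕ} {u v : List Pass} (hu : u ~ [(p, true), (q, true), (q', true)])
    (hv : v ~ [(r, false), (q, false), (q', false)]) (x : Pass) :
    blocks p r u v x ~ doubled p r q q' x := by
  unfold blocks doubled
  split_ifs with h1 h2 h3 h4 h5
  · subst h1; exact hu
  · simp_all
  · subst h3; exact hv
  · simp_all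
  · simp_all
  · rfl

/-- A third Reidemeister move on the triangle `p`, `q`, `r`, followed by forbidden moves which restore
the order on the top and the bottom strand, transposes an underpass and an overpass. The crossing
`q` comes from a second Reidemeister move which creates the pair `q`, `q'`. The order of `q` and `r`
on the bottom strand is dictated by the signs of `p` and `r`. -/
theorem SwapAt.fusedIsotopic_of_insertable {p r q q' : ℕ} (hpr : p ≠ r) {D D' : GaussDiagram n}
    (hs : SwapAt (p, false) (r, true) D D') (h : D.Insertable p r q q')
    (hq : D.sign q = D.sign r) (hq' : D.sign q' = - D.sign r) : FusedIsotopic D D' := by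
  have h' : D'.Insertable p r q q' := by
    constructor
    · rw [hs.mem_crossings]; exact h.mem_left
    · rw [hs.mem_crossings]; exact h.mem_right
    · rw [hs.mem_crossings]; exact h.notMem
    · rw [hs.mem_crossings]; exact h.notMem'
    · exact h.ne
  have hpq : p ≠ q := fun e => h.notMem (e ▸ h.mem_left)
  have hrq : r ≠ q := fun e => h.notMem (e ▸ h.mem_right)
  -- On the top strand `q` and `q'` come after `p`. On the bottom strand the order of `q` and `r` is the
  -- one which the sign condition of the third Reidemeister move demands, with `q'` next to `q` on the
  -- side away from `r`.
  let u₁ : List Pass := [(p, true), (q, true), (q', true)]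
  let u₂ : List Pass := [(q, true), (p, true), (q', true)]
  have hu₁ : u₁ ~ [(p, true), (q, true), (q', true)] := List.Perm.refl _
  have hu₂ : u₂ ~ [(p, true), (q, true), (q', true)] := List.Perm.swap _ _ _
  obtain ⟨x, y, A, B, hv, hadj, hxy⟩ : ∃ (x y : Pass) (A B : List Pass),
      (A ++ x :: y :: B ~ [(r, false), (q, false), (q', false)]) ∧
      ((∃ A' B', A ++ x :: y :: B = A' ++ (q, false) :: (q', false) :: B') ∨
        ∃ A' B', A ++ x :: y :: B = A' ++ (q', false) :: (q, false) :: B') ∧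
      ((D.sign p * D.sign r = 1 ∧ x = (q, false) ∧ y = (r, false)) ∨
        (D.sign p * D.sign r = -1 ∧ x = (r, false) ∧ y = (q, false))) := by
    rcases Int.units_eq_one_or (D.sign p * D.sign r) with e | e
    · refine ⟨(q, false), (r, false), [(q', false)], [], ?_, Or.inr ⟨[], [(r, false)], rfl⟩,
        Or.inl ⟨e, rfl, rfl⟩⟩
      exact (List.reverse_perm [(r, false), (q, false), (q', false)])
    · exact ⟨(r, false), (q, false), [], [(q', false)], List.Perm.refl _,
        Or.inl ⟨[(r, false)], [], rfl⟩, Or.inr ⟨e, rfl, rfl⟩⟩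
  have hv' : A ++ y :: x :: B ~ [(r, false), (q, false), (q', false)] :=
    ((List.Perm.swap _ _ _).append_left _).trans hv
  have hP : ∀ u v, blocks p r u v (p, true) = u := by simp [blocks]
  have hR : ∀ u v, blocks p r u v (r, false) = v := by simp [blocks]
  have hU : ∀ u u' v z, z ≠ (p, true) → blocks p r u v z = blocks p r u' v z := by
    intro u u' v z hz; simp [blocks, hz]
  have hV : ∀ u v v' z, z ≠ (r, false) → blocks p r u v z = blocks p r u v' z := by
    intro u v v' z hz; simp [blocks, hz]
  have r2 : ∀ {E : GaussDiagram n} (hE : E.Insertable p r q q') (_ : E.sign q = - E.sign q'),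
      FusedIsotopic (E.insertPair hE _ (blocks_perm hu₁ hv)) E := by
    intro E hE hsE
    refine FusedMove.fusedIsotopic (Or.inr (Or.inr (Or.inl ⟨q, q', h.ne, hsE, ?_, ?_,
      isDeletion_insertPair hE _⟩)))
    · exact adj_insertPair hE _ (z := (p, true)) hE.mem_left (A := [(p, true)]) (B := []) (hP _ _)
    · rcases hadj with ⟨A', B', e⟩ | ⟨A', B', e⟩
      · exact Or.inl (adj_insertPair hE _ (z := (r, false)) hE.mem_right ((hR _ _).trans e))
      · exact Or.inr (adj_insertPair hE _ (z := (r, false)) hE.mem_right ((hR _ _).trans e))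
  have hss : D'.sign = D.sign := hs.2
  have s1 : SwapAt (p, true) (q, true) (D.insertPair h _ (blocks_perm hu₁ hv))
      (D.insertPair h _ (blocks_perm hu₂ hv)) :=
    swapAt_insertPair h _ _ (z := (p, true)) h.mem_left (hU _ _ _) (A := []) (hP _ _) (hP _ _)
  have s2 : SwapAt (p, false) (r, true) (D.insertPair h _ (blocks_perm hu₂ hv))
      (D'.insertPair h' _ (blocks_perm hu₂ hv)) :=
    hs.insertPair h _ h' (by simp [blocks, hpr]) (by simp [blocks, hpr.symm])
  have s3 : SwapAt x y (D'.insertPair h' _ (blocks_perm hu₂ hv))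
      (D'.insertPair h' _ (blocks_perm hu₂ hv')) :=
    swapAt_insertPair h' _ _ (z := (r, false)) h'.mem_right (hV _ _ _) (hR _ _) (hR _ _)
  have s4 : SwapAt (q, true) (p, true) (D'.insertPair h' _ (blocks_perm hu₂ hv'))
      (D'.insertPair h' _ (blocks_perm hu₁ hv')) :=
    swapAt_insertPair h' _ _ (z := (p, true)) h'.mem_left (hU _ _ _) (A := []) (hP _ _) (hP _ _)
  have s5 : SwapAt y x (D'.insertPair h' _ (blocks_perm hu₁ hv'))
      (D'.insertPair h' _ (blocks_perm hu₁ hv)) :=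
    swapAt_insertPair h' _ _ (z := (r, false)) h'.mem_right (hV _ _ _) (hR _ _) (hR _ _)
  have r3 : R3 (D.insertPair h _ (blocks_perm hu₁ hv))
      (D'.insertPair h' _ (blocks_perm hu₂ hv')) := by
    refine ⟨p, q, r, 1, 1, D.sign p * D.sign r, D.sign r, hpq, hpr, hrq.symm, ?_, ?_, ?_,
      D.insertPair h _ (blocks_perm hu₂ hv), D'.insertPair h' _ (blocks_perm hu₂ hv), ?_, ?_, ?_⟩
    · change D.sign p = _
      rw [mul_comm (D.sign p), ← mul_assoc, Int.units_mul_self, one_mul]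
    · change D.sign q = _
      rw [hq, mul_one]
    · change D.sign r = _
      rw [mul_one]
    · simpa [OrientedSwap] using s1
    · simpa [OrientedSwap] using s2
    · rcases hxy with ⟨e, rfl, rfl⟩ | ⟨e, rfl, rfl⟩
      · rw [e]; simpa [OrientedSwap] using s3
      · rw [e]
        unfold OrientedSwap
        rw [if_neg (by decide)]
        exact s3
  have fo := FusedMove.fusedIsotopic (Or.inr (Or.inr (Or.inr (Or.inr (Or.inl ⟨q, p, s4⟩)))))
  have fu : FusedIsotopic (D'.insertPair h' _ (blocks_perm hu₁ hv'))
      (D'.insertPair h' _ (blocks_perm hu₁ hv)) := by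
    refine FusedMove.fusedIsotopic (Or.inr (Or.inr (Or.inr (Or.inr (Or.inr ?_)))))
    rcases hxy with ⟨-, rfl, rfl⟩ | ⟨-, rfl, rfl⟩
    · exact ⟨r, q, s5⟩
    · exact ⟨q, r, s5⟩
  have hsq : D.sign q = - D.sign q' := by rw [hq, hq', neg_neg]
  exact (r2 h hsq).symm.trans ((FusedMove.fusedIsotopic (Or.inr (Or.inr (Or.inr (Or.inl r3))))).trans
    (fo.trans (fu.trans (r2 h' (by rw [hss]; exact hsq)))))

/-- An underpass and an overpass directly after it, at different crossings, can be transposed. As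
fused isotopy is symmetric, this covers the opposite order as well. -/
theorem SwapAt.fusedIsotopic_under_over {p r : ℕ} (hpr : p ≠ r) {D D' : GaussDiagram n}
    (hs : SwapAt (p, false) (r, true) D D') : FusedIsotopic D D' := by
  obtain ⟨q, hq⟩ := Infinite.exists_notMem_finset D.crossings
  obtain ⟨q', hq'⟩ := Infinite.exists_notMem_finset (insert q D.crossings)
  rw [Finset.mem_insert, not_or] at hq'
  have hp : p ∈ D.crossings := by
    obtain ⟨⟨i, l, h1, -⟩, -⟩ := hs
    exact mem_crossings_of_mem (p := (p, false)) (h1.mem_iff.2 (by simp))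
  have hr : r ∈ D.crossings := by
    obtain ⟨⟨i, l, h1, -⟩, -⟩ := hs
    exact mem_crossings_of_mem (p := (r, true)) (h1.mem_iff.2 (by simp))
  have hrq : r ≠ q := fun e => hq (e ▸ hr)
  have hrq' : r ≠ q' := fun e => hq'.2 (e ▸ hr)
  -- The second Reidemeister move requires the new crossings to have signs `sign r` and `-sign r`.
  let σ : ℕ → ℤˣ := Function.update (Function.update D.sign q (D.sign r)) q' (- D.sign r)
  have hσ : ∀ c ∈ D.crossings, σ c = D.sign c := by
    intro c hc
    have h1 : c ≠ q := fun e => hq (e ▸ hc)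
    have h2 : c ≠ q' := fun e => hq'.2 (e ▸ hc)
    simp [σ, h1, h2]
  have hσ' : ∀ c ∈ D'.crossings, σ c = D'.sign c := by
    intro c hc
    rw [hs.2]
    exact hσ c ((hs.mem_crossings c).1 hc)
  refine (D.fusedIsotopic_setSign hσ).trans (FusedIsotopic.trans ?_
    (D'.fusedIsotopic_setSign hσ').symm)
  refine SwapAt.fusedIsotopic_of_insertable (q := q) (q' := q') hpr ⟨hs.1, rfl⟩
    ⟨hp, hr, hq, hq'.2, fun e => hq'.1 e.symm⟩ ?_ ?_
  · change σ q = σ r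
    simp [σ, hrq, hrq', Ne.symm hq'.1]
  · change σ q' = - σ r
    simp [σ, hrq, hrq']

/-- The two passages of a curl can be transposed: both curls are removed by first Reidemeister moves,
with the same result. -/
theorem SwapAt.fusedIsotopic_self {c : ℕ} {b : Bool} {D D' : GaussDiagram n}
    (hs : SwapAt (c, b) (c, !b) D D') : FusedIsotopic D D' := by
  obtain ⟨⟨i, l, h1, h2, h3⟩, h4⟩ := hs
  have r : FusedIsotopic D (D.delete {c}) := FusedMove.fusedIsotopic
    (Or.inr (Or.inl ⟨c, b, ⟨i, l, h1⟩, D.isDeletion_delete _⟩))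
  refine r.trans (FusedIsotopic.symm (FusedMove.fusedIsotopic
    (Or.inr (Or.inl ⟨c, !b, ⟨i, l, by simpa using h2⟩, fun j => ?_, h4.symm⟩))))
  change (D.strand j).filter _ ~r _
  by_cases hj : j = i
  · subst hj
    refine (h1.filter_of _).trans (List.IsRotated.trans ?_ (h2.filter_of _).symm)
    simp [List.IsRotated.refl]
  · exact (h3 j hj).symm.filter_of _

/-- Up to fused isotopy, any two consecutive passages can be transposed. -/
theorem SwapAt.fusedIsotopic {x y : Pass} {D D' : GaussDiagram n} (hs : SwapAt x y D D') :
    FusedIsotopic D D' := by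
  obtain ⟨a, ba⟩ := x
  obtain ⟨b, bb⟩ := y
  by_cases hab : a = b
  · subst hab
    by_cases hb : bb = !ba
    · subst hb
      exact hs.fusedIsotopic_self
    · obtain rfl : ba = bb := by cases ba <;> cases bb <;> simp_all
      obtain ⟨⟨i, l, h1, -⟩, -⟩ := hs
      have := h1.nodup_iff.1 (D.nodup_strand i)
      simp at this
  · cases ba <;> cases bb
    · exact FusedMove.fusedIsotopic (Or.inr (Or.inr (Or.inr (Or.inr (Or.inr ⟨a, b, hs⟩)))))
    · exact hs.fusedIsotopic_under_over hab
    · exact (hs.symm.fusedIsotopic_under_over (Ne.symm hab)).symm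
    · exact FusedMove.fusedIsotopic (Or.inr (Or.inr (Or.inr (Or.inr (Or.inl ⟨a, b, hs⟩)))))

/-- The common initial part `A` makes the induction on the permutation possible. -/
theorem fusedIsotopic_of_perm_append {i : Fin n} {l l' : List Pass} (h : l ~ l') :
    ∀ (A : List Pass) (D D' : GaussDiagram n), D.strand i = A ++ l → D'.strand i = A ++ l' →
      (∀ j, j ≠ i → D'.strand j = D.strand j) → D'.sign = D.sign → FusedIsotopic D D' := by
  induction h with
  | nil =>
    intro A D D' h1 h2 h3 h4
    refine fusedIsotopic_of_isRotated (fun j => ?_) fun c _ => by rw [h4]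
    by_cases hj : j = i
    · subst hj; rw [h1, h2]
    · rw [h3 j hj]
  | cons x _ ih =>
    intro A D D' h1 h2 h3 h4
    exact ih (A ++ [x]) D D' (by simpa using h1) (by simpa using h2) h3 h4
  | swap x y l =>
    intro A D D' h1 h2 h3 h4
    refine SwapAt.fusedIsotopic (x := y) (y := x) ⟨⟨i, l ++ A, ?_, ?_, fun j hj => ?_⟩, h4⟩
    · rw [h1]; exact List.isRotated_append
    · rw [h2]; exact List.isRotated_append
    · rw [h3 j hj]
  | @trans l₁ l₂ l₃ h12 _ ih1 ih2 =>
    intro A D D' h1 h2 h3 h4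
    have hp : ∀ j, Function.update D.strand i (A ++ l₂) j ~ D.strand j := by
      intro j
      by_cases hj : j = i
      · subst hj
        rw [Function.update_self, h1]
        exact h12.symm.append_left A
      · rw [Function.update_of_ne hj]
    refine (ih1 A D (D.withStrand _ hp) h1 ?_ ?_ rfl).trans (ih2 A _ D' ?_ h2 ?_ h4)
    · simp [withStrand]
    · intro j hj; simp [withStrand, hj]
    · simp [withStrand]
    · intro j hj; simp [withStrand, hj, h3 j hj]

/-- Up to fused isotopy, the order of the passages on a component does not matter. -/
theorem fusedIsotopic_of_perm {D D' : GaussDiagram n} (h : ∀ i, D'.strand i ~ D.strand i)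
    (hs : D'.sign = D.sign) : FusedIsotopic D D' := by
  suffices H : ∀ (s : Finset (Fin n)) (D' : GaussDiagram n), (∀ i, D'.strand i ~ D.strand i) →
      (∀ i, i ∉ s → D'.strand i = D.strand i) → D'.sign = D.sign → FusedIsotopic D D' from
    H Finset.univ D' h (by simp) hs
  intro s
  induction s using Finset.induction_on with
  | empty =>
    intro D' _ h2 h3
    exact fusedIsotopic_of_isRotated (fun i => by rw [h2 i (by simp)]) fun c _ => by rw [h3]
  | insert i s _ ih =>
    intro D' h1 h2 h3
    have hp : ∀ j, Function.update D'.strand i (D.strand i) j ~ D.strand j := by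
      intro j
      by_cases hj : j = i
      · subst hj; rw [Function.update_self]
      · rw [Function.update_of_ne hj]; exact h1 j
    refine (ih (D.withStrand _ hp) hp (fun j hj => ?_) rfl).trans
      (fusedIsotopic_of_perm_append (i := i) (h1 i).symm [] _ D' ?_ rfl ?_ h3)
    · by_cases hji : j = i
      · subst hji; simp [withStrand]
      · simp only [withStrand, Function.update_of_ne hji]
        exact h2 j (by simp [hji, hj])
    · simp [withStrand]
    · intro j hj; simp [withStrand, hj]

theorem fusedIsotopic_withStrand (D : GaussDiagram n) (s : Fin n → List Pass)
    (hs : ∀ i, s i ~ D.strand i) : FusedIsotopic D (D.withStrand s hs) :=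
  fusedIsotopic_of_perm hs rfl

/-! ### Classification by the ordered linking numbers -/

/-- The crossings of sign `ε` at which the component `i` passes over the component `j`. -/
def kind (D : GaussDiagram n) (i j : Fin n) (ε : ℤˣ) : Finset ℕ :=
  D.crossings.filter fun c => (c, true) ∈ D.strand i ∧ (c, false) ∈ D.strand j ∧ D.sign c = ε

theorem mem_kind {D : GaussDiagram n} {i j : Fin n} {ε : ℤˣ} {c : ℕ} :
    c ∈ D.kind i j ε ↔ (c, true) ∈ D.strand i ∧ (c, false) ∈ D.strand j ∧ D.sign c = ε := by
  simp only [kind, Finset.mem_filter, and_iff_right_iff_imp]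
  exact fun h => mem_crossings_of_mem h.1

theorem vlk_eq_card_sub (D : GaussDiagram n) (i j : Fin n) :
    D.vlk i j = (D.kind i j 1).card - (D.kind i j (-1)).card := by
  have e : (D.crossings.filter fun c => (c, true) ∈ D.strand i ∧ (c, false) ∈ D.strand j) =
      D.kind i j 1 ∪ D.kind i j (-1) := by
    ext c
    simp only [Finset.mem_filter, Finset.mem_union, mem_kind]
    constructor
    · rintro ⟨-, h1, h2⟩
      rcases Int.units_eq_one_or (D.sign c) with h | h
      · exact Or.inl ⟨h1, h2, h⟩
      · exact Or.inr ⟨h1, h2, h⟩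
    · rintro (⟨h1, h2, -⟩ | ⟨h1, h2, -⟩) <;> exact ⟨mem_crossings_of_mem h1, h1, h2⟩
  have hd : Disjoint (D.kind i j 1) (D.kind i j (-1)) := by
    rw [Finset.disjoint_left]
    intro c h1 h2
    have := (mem_kind.1 h1).2.2.symm.trans (mem_kind.1 h2).2.2
    revert this; decide
  unfold vlk
  rw [e, Finset.sum_union hd, Finset.sum_congr rfl (g := fun _ => (1 : ℤ)),
    Finset.sum_congr (s₁ := D.kind i j (-1)) rfl (g := fun _ => (-1 : ℤ))]
  · simp [sub_eq_add_neg]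
  · intro c hc; rw [(mem_kind.1 hc).2.2]; rfl
  · intro c hc; rw [(mem_kind.1 hc).2.2]; rfl

/-- No component crosses itself, and no two crossings between the same components, with the same
component on top, have opposite signs. -/
structure IsReduced (D : GaussDiagram n) : Prop where
  self (i : Fin n) (ε : ℤˣ) : D.kind i i ε = ∅
  pair (i j : Fin n) : D.kind i j 1 = ∅ ∨ D.kind i j (-1) = ∅

theorem IsReduced.card_kind_eq {D D' : GaussDiagram n} (h : D.IsReduced) (h' : D'.IsReduced)
    (hv : ∀ i j, i ≠ j → D.vlk i j = D'.vlk i j) (i j : Fin n) (ε : ℤˣ) :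
    (D.kind i j ε).card = (D'.kind i j ε).card := by
  by_cases hij : i = j
  · subst hij; rw [h.self, h'.self]
  · have e := hv i j hij
    rw [vlk_eq_card_sub, vlk_eq_card_sub] at e
    have h1 : (D.kind i j 1).card = 0 ∨ (D.kind i j (-1)).card = 0 := by
      simpa only [Finset.card_eq_zero] using h.pair i j
    have h2 : (D'.kind i j 1).card = 0 ∨ (D'.kind i j (-1)).card = 0 := by
      simpa only [Finset.card_eq_zero] using h'.pair i j
    rcases Int.units_eq_one_or ε with rfl | rfl <;> omega

/-- The component on which a passage lies. -/
noncomputable def comp (D : GaussDiagram n) (p : Pass) (hp : p.1 ∈ D.crossings) : Fin n :=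
  ((D.mem_crossings_iff p).1 hp).choose

theorem mem_strand_comp (D : GaussDiagram n) (p : Pass) (hp : p.1 ∈ D.crossings) :
    p ∈ D.strand (D.comp p hp) :=
  ((D.mem_crossings_iff p).1 hp).choose_spec

theorem mem_strand_iff_comp_eq (D : GaussDiagram n) (p : Pass) (hp : p.1 ∈ D.crossings) (i : Fin n) :
    p ∈ D.strand i ↔ D.comp p hp = i :=
  ⟨fun h => strand_unique (D.mem_strand_comp p hp) h, fun h => h ▸ D.mem_strand_comp p hp⟩

/-- Two diagrams with the same numbers of crossings of each kind have the same crossings, up to the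
labels, so they differ only in the order of the passages on the components. -/
theorem fusedIsotopic_of_card_kind {D D' : GaussDiagram n}
    (h : ∀ i j ε, (D.kind i j ε).card = (D'.kind i j ε).card) : FusedIsotopic D D' := by
  classical
  -- The type of a crossing: its upper and lower component and its sign.
  let ty (E : GaussDiagram n) (c : {c // c ∈ E.crossings}) : Fin n × Fin n × ℤˣ :=
    (E.comp (c.1, true) c.2, E.comp (c.1, false) c.2, E.sign c.1)
  have fib (E : GaussDiagram n) (t : Fin n × Fin n × ℤˣ) :
      Nonempty ({c // ty E c = t} ≃ {c // c ∈ E.kind t.1 t.2.1 t.2.2}) := by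
    have key : ∀ (c : ℕ) (hc : c ∈ E.crossings), ty E ⟨c, hc⟩ = t ↔ c ∈ E.kind t.1 t.2.1 t.2.2 := by
      intro c hc
      rw [mem_kind, E.mem_strand_iff_comp_eq (c, true) hc, E.mem_strand_iff_comp_eq (c, false) hc]
      simp only [ty, Prod.ext_iff]
    exact ⟨{
      toFun := fun c => ⟨c.1.1, (key _ c.1.2).1 c.2⟩
      invFun := fun c => ⟨⟨c.1, mem_crossings_of_mem (mem_kind.1 c.2).1⟩, (key _ _).2 c.2⟩
      left_inv := fun _ => rfl
      right_inv := fun _ => rfl }⟩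
  have e0 (t : Fin n × Fin n × ℤˣ) : Nonempty ({c // ty D c = t} ≃ {c // ty D' c = t}) := by
    obtain ⟨a⟩ := fib D t
    obtain ⟨b⟩ := fib D' t
    exact ⟨a.trans ((Finset.equivOfCardEq (h _ _ _)).trans b.symm)⟩
  let e (t : Fin n × Fin n × ℤˣ) := (e0 t).some
  let g : {c // c ∈ D.crossings} ≃ {c // c ∈ D'.crossings} :=
    (Equiv.sigmaFiberEquiv (ty D)).symm.trans
      ((Equiv.sigmaCongrRight e).trans (Equiv.sigmaFiberEquiv (ty D')))
  have hg : ∀ c, ty D' (g c) = ty D c := fun c => (e (ty D c) ⟨c, rfl⟩).2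
  -- The bijection of the crossings extends to all labels, as both complements are countably infinite.
  have : Infinite {c // c ∉ D.crossings} := D.crossings.finite_toSet.infinite_compl.to_subtype
  have : Infinite {c // c ∉ D'.crossings} := D'.crossings.finite_toSet.infinite_compl.to_subtype
  obtain ⟨g'⟩ : Nonempty ({c // c ∉ D.crossings} ≃ {c // c ∉ D'.crossings}) :=
    nonempty_equiv_of_countable
  let f : Equiv.Perm ℕ := Equiv.subtypeCongr g g'
  have hfg : ∀ c (hc : c ∈ D.crossings), f c = g ⟨c, hc⟩ := by
    intro c hc
    simp [f, Equiv.subtypeCongr, Equiv.sumCompl, hc]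
  have hfc : ∀ c, f c ∈ D'.crossings ↔ c ∈ D.crossings := by
    intro c
    by_cases hc : c ∈ D.crossings
    · simp only [hc, iff_true]; rw [hfg c hc]; exact (g ⟨c, hc⟩).2
    · simp only [hc, iff_false]
      have : f c = g' ⟨c, hc⟩ := by simp [f, Equiv.subtypeCongr, Equiv.sumCompl, hc]
      rw [this]; exact (g' ⟨c, hc⟩).2
  have hmem : ∀ i c b, (f c, b) ∈ D'.strand i ↔ (c, b) ∈ D.strand i := by
    intro i c b
    by_cases hc : c ∈ D.crossings
    · have hc' := (hfc c).2 hc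
      have ht := hg ⟨c, hc⟩
      have hgc : g ⟨c, hc⟩ = ⟨f c, hc'⟩ := Subtype.ext (hfg c hc).symm
      rw [hgc] at ht
      simp only [ty, Prod.ext_iff] at ht
      rw [D.mem_strand_iff_comp_eq (c, b) hc, D'.mem_strand_iff_comp_eq (f c, b) hc']
      cases b
      · rw [ht.2.1]
      · rw [ht.1]
    · exact ⟨fun h => absurd ((hfc c).1 (mem_crossings_of_mem h)) hc,
        fun h => absurd (mem_crossings_of_mem h) hc⟩
  have hfi : Function.Injective fun p : Pass => ((f p.1, p.2) : Pass) := by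
    rintro ⟨a, b⟩ ⟨a', b'⟩ hab
    simpa using hab
  have hperm : ∀ i, (D.strand i).map (fun p => (f p.1, p.2)) ~ D'.strand i := by
    intro i
    rw [List.perm_ext_iff_of_nodup ((D.nodup_strand i).map hfi) (D'.nodup_strand i)]
    rintro ⟨c, b⟩
    obtain ⟨c, rfl⟩ := f.surjective c
    rw [hmem]
    simp
  -- Relabelling `D` by `f` gives `D'` with rearranged components.
  refine FusedIsotopic.trans (FusedMove.fusedIsotopic (Or.inl ⟨f, fun i => ?_, ?_⟩))
    (fusedIsotopic_withStrand D' _ hperm).symm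
  · exact List.IsRotated.refl _
  · intro c hc
    have ht := hg ⟨c, hc⟩
    simp only [ty, Prod.ext_iff] at ht
    change D'.sign (f c) = _
    rw [hfg c hc]
    exact ht.2.2

theorem exists_remove_self {D : GaussDiagram n} {i : Fin n} {ε : ℤˣ} {c : ℕ}
    (hc : c ∈ D.kind i i ε) :
    ∃ D' : GaussDiagram n, FusedIsotopic D D' ∧ D'.crossings.card < D.crossings.card := by
  obtain ⟨h1, h2, -⟩ := mem_kind.1 hc
  have hp : ∀ j, Function.update D.strand i
      ((c, true) :: (c, false) :: ((D.strand i).erase (c, true)).erase (c, false)) j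
        ~ D.strand j := by
    intro j
    by_cases hj : j = i
    · subst hj
      rw [Function.update_self]
      exact ((List.perm_cons_erase h1).trans ((List.perm_cons_erase
        ((List.mem_erase_of_ne (by simp)).2 h2)).cons _)).symm
    · rw [Function.update_of_ne hj]
  have hadj : (D.withStrand _ hp).Adj (c, true) (c, !true) :=
    ⟨i, ((D.strand i).erase (c, true)).erase (c, false),
      List.isRotated_of_eq (Function.update_self ..)⟩
  refine ⟨(D.withStrand _ hp).delete {c}, (D.fusedIsotopic_withStrand _ hp).trans
    (FusedMove.fusedIsotopic (Or.inr (Or.inl ⟨c, true, hadj, isDeletion_delete _ _⟩))), ?_⟩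
  · refine Finset.card_lt_card (Finset.sdiff_ssubset ?_ (by simp))
    exact Finset.singleton_subset_iff.2 (mem_crossings_of_mem h1)

theorem exists_remove_pair {D : GaussDiagram n} {i j : Fin n} (hij : i ≠ j) {a b : ℕ}
    (ha : a ∈ D.kind i j 1) (hb : b ∈ D.kind i j (-1)) :
    ∃ D' : GaussDiagram n, FusedIsotopic D D' ∧ D'.crossings.card < D.crossings.card := by
  obtain ⟨a1, a2, a3⟩ := mem_kind.1 ha
  obtain ⟨b1, b2, b3⟩ := mem_kind.1 hb
  have hab : a ≠ b := by
    rintro rfl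
    have := a3.symm.trans b3
    revert this; decide
  let front (k : Fin n) (x y : Pass) : List Pass := x :: y :: ((D.strand k).erase x).erase y
  have hfront : ∀ k x y, x ∈ D.strand k → y ∈ D.strand k → y ≠ x → front k x y ~ D.strand k := by
    intro k x y hx hy hxy
    exact ((List.perm_cons_erase hx).trans ((List.perm_cons_erase
        ((List.mem_erase_of_ne hxy).2 hy)).cons _)).symm
  have hp : ∀ k, Function.update (Function.update D.strand i (front i (a, true) (b, true))) j
      (front j (a, false) (b, false)) k ~ D.strand k := by
    intro k
    by_cases hj : k = j
    · subst hj
      rw [Function.update_self]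
      exact hfront _ _ _ a2 b2 (by simp [hab.symm])
    · rw [Function.update_of_ne hj]
      by_cases hi : k = i
      · subst hi
        rw [Function.update_self]
        exact hfront _ _ _ a1 b1 (by simp [hab.symm])
      · rw [Function.update_of_ne hi]
  have hover : (D.withStrand _ hp).Adj (a, true) (b, true) :=
    ⟨i, ((D.strand i).erase (a, true)).erase (b, true), List.isRotated_of_eq
      ((Function.update_of_ne hij ..).trans (Function.update_self ..))⟩
  have hunder : (D.withStrand _ hp).Adj (a, false) (b, false) :=
    ⟨j, ((D.strand j).erase (a, false)).erase (b, false),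
      List.isRotated_of_eq (Function.update_self ..)⟩
  refine ⟨(D.withStrand _ hp).delete {a, b}, (D.fusedIsotopic_withStrand _ hp).trans
    (FusedMove.fusedIsotopic (Or.inr (Or.inr (Or.inl ⟨a, b, hab, ?_,
      hover, Or.inl hunder, isDeletion_delete _ _⟩)))), ?_⟩
  · change D.sign a = - D.sign b
    rw [a3, b3, neg_neg]
  · refine Finset.card_lt_card (Finset.sdiff_ssubset ?_ (by simp))
    intro c hc
    rcases Finset.mem_insert.1 hc with rfl | hc
    · exact mem_crossings_of_mem a1
    · obtain rfl := Finset.mem_singleton.1 hc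
      exact mem_crossings_of_mem b1

theorem exists_isReduced (D : GaussDiagram n) :
    ∃ D' : GaussDiagram n, FusedIsotopic D D' ∧ D'.IsReduced := by
  induction hN : D.crossings.card using Nat.strong_induction_on generalizing D with
  | _ N ih =>
    by_cases hD : D.IsReduced
    · exact ⟨D, Relation.EqvGen.refl _, hD⟩
    suffices H : ∃ D' : GaussDiagram n, FusedIsotopic D D' ∧
        D'.crossings.card < D.crossings.card by
      obtain ⟨D', h1, h2⟩ := H
      obtain ⟨D'', h3, h4⟩ := ih _ (hN ▸ h2) D' rfl
      exact ⟨D'', h1.trans h3, h4⟩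
    by_contra hn
    have hself : ∀ i ε, D.kind i i ε = ∅ := fun i ε =>
      Finset.eq_empty_of_forall_notMem fun c hc => hn (exists_remove_self hc)
    refine hD ⟨hself, fun i j => ?_⟩
    by_cases hij : i = j
    · subst hij; exact Or.inl (hself _ _)
    · by_contra! h
      obtain ⟨⟨a, ha⟩, ⟨b, hb⟩⟩ := h
      exact hn (exists_remove_pair hij ha hb)

/-- The ordered linking numbers classify virtual link diagrams up to fused isotopy. -/
theorem fusedIsotopic_iff_vlk {D D' : GaussDiagram n} :
    FusedIsotopic D D' ↔ ∀ i j, i ≠ j → D.vlk i j = D'.vlk i j := by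
  refine ⟨fun h i j hij => (h.vlk_eq hij).symm, fun h => ?_⟩
  obtain ⟨E, h1, h2⟩ := D.exists_isReduced
  obtain ⟨E', h1', h2'⟩ := D'.exists_isReduced
  refine h1.trans ((fusedIsotopic_of_card_kind (h2.card_kind_eq h2' fun i j hij => ?_)).trans
    h1'.symm)
  rw [h1.vlk_eq hij, h1'.vlk_eq hij, h i j hij]

/-! ### Classical diagrams -/

section Planar

variable (D : GaussDiagram n)

/-- The passages of `D`. A passage also stands for the edge which starts there. -/
abbrev PassOf : Type := {p : Pass // p.1 ∈ D.crossings}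

theorem next_of_mem {p : Pass} {i : Fin n} (hp : p ∈ D.strand i) :
    D.Next p ((D.strand i).formPerm p) := by
  obtain ⟨m, hm⟩ := List.exists_isRotated_cons hp
  rw [List.formPerm_eq_of_isRotated (D.nodup_strand i) hm]
  cases m with
  | nil =>
    exact ⟨i, Or.inl ⟨List.isRotated_singleton_iff.1 hm, by simp⟩⟩
  | cons y l =>
    refine ⟨i, Or.inr ⟨l, ?_⟩⟩
    rwa [List.formPerm_apply_head _ _ _ (hm.nodup_iff.1 (D.nodup_strand i))]

variable {D} in
theorem Next.eq_formPerm {p q : Pass} (h : D.Next p q) :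
    ∃ i, p ∈ D.strand i ∧ q = (D.strand i).formPerm p := by
  obtain ⟨i, ⟨h1, rfl⟩ | ⟨l, hl⟩⟩ := h
  · exact ⟨i, by simp [h1], by simp [h1]⟩
  · refine ⟨i, hl.mem_iff.2 (by simp), ?_⟩
    rw [List.formPerm_eq_of_isRotated (D.nodup_strand i) hl,
      List.formPerm_apply_head _ _ _ (hl.nodup_iff.1 (D.nodup_strand i))]

variable {D} in
theorem formPerm_symm_mem {i : Fin n} {p : Pass} (hp : p ∈ D.strand i) :
    (D.strand i).formPerm.symm p ∈ D.strand i := by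
  rw [← List.formPerm_mem_iff_mem, Equiv.apply_symm_apply]
  exact hp

/-- The permutation taking each passage to the next one on its component. -/
noncomputable def next : Equiv.Perm D.PassOf where
  toFun p := ⟨(D.strand (D.comp p.1 p.2)).formPerm p.1,
    mem_crossings_of_mem (List.formPerm_apply_mem_of_mem (D.mem_strand_comp p.1 p.2))⟩
  invFun p := ⟨(D.strand (D.comp p.1 p.2)).formPerm.symm p.1,
    mem_crossings_of_mem (formPerm_symm_mem (D.mem_strand_comp p.1 p.2))⟩
  left_inv p := by
    apply Subtype.ext
    have h := List.formPerm_apply_mem_of_mem (D.mem_strand_comp p.1 p.2)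
    simp only [(D.mem_strand_iff_comp_eq _ (mem_crossings_of_mem h) _).1 h,
      Equiv.symm_apply_apply]
  right_inv p := by
    apply Subtype.ext
    have h := formPerm_symm_mem (D.mem_strand_comp p.1 p.2)
    simp only [(D.mem_strand_iff_comp_eq _ (mem_crossings_of_mem h) _).1 h,
      Equiv.apply_symm_apply]

theorem next_apply {p : D.PassOf} {i : Fin n} (hp : p.1 ∈ D.strand i) :
    (D.next p).1 = (D.strand i).formPerm p.1 := by
  obtain rfl := (D.mem_strand_iff_comp_eq _ p.2 _).1 hp
  rfl

theorem next_next (p : D.PassOf) : D.Next p.1 (D.next p).1 :=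
  D.next_of_mem (D.mem_strand_comp p.1 p.2)

variable {D} in
theorem Next.eq_next {p q : Pass} (h : D.Next p q) (hp : p.1 ∈ D.crossings) :
    q = (D.next ⟨p, hp⟩).1 := by
  obtain ⟨i, h1, h2⟩ := h.eq_formPerm
  rw [h2, D.next_apply (p := ⟨p, hp⟩) h1]

theorem next_mem_iff (p : D.PassOf) (i : Fin n) : (D.next p).1 ∈ D.strand i ↔ p.1 ∈ D.strand i := by
  have h := D.mem_strand_comp p.1 p.2
  have h' := List.formPerm_apply_mem_of_mem h
  rw [← D.next_apply h] at h'
  exact ⟨fun hi => by rwa [strand_unique hi h'], fun hi => by rwa [strand_unique hi h]⟩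

/-- The involution exchanging the two passages through each crossing. -/
def flip : Equiv.Perm D.PassOf where
  toFun p := ⟨p.1.flip, p.2⟩
  invFun p := ⟨p.1.flip, p.2⟩
  left_inv p := by simp [Pass.flip]
  right_inv p := by simp [Pass.flip]

@[simp] theorem flip_flip (p : D.PassOf) : D.flip (D.flip p) = p := D.flip.left_inv p

/-- The face on the left of the half-edge which leaves the passage `p` in the direction `ε`. -/
def face (p : D.PassOf) (ε : ℤˣ) : D.Face := Quot.mk _ ⟨(p.1, ε), p.2⟩

theorem face_symm_next (p : D.PassOf) :
    D.face (D.next.symm p) 1 = D.face (D.flip p) (D.turn p.1) := by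
  refine Quot.sound ⟨p.1, Or.inl ⟨rfl, ?_⟩, ?_⟩
  · simpa using D.next_next (D.next.symm p)
  · simp [flip]

theorem face_next (p : D.PassOf) :
    D.face (D.next p) (-1) = D.face (D.flip p) (-D.turn p.1) := by
  refine Quot.sound ⟨p.1, Or.inr ⟨rfl, D.next_next p⟩, ?_⟩
  simp [flip]

theorem turn_flip (p : D.PassOf) : D.turn (D.flip p).1 = - D.turn p.1 := by
  obtain ⟨⟨c, b⟩, hp⟩ := p
  cases b <;> simp [turn, flip, Pass.flip]

/-- The crossing of a passage. -/
def crossing (p : D.PassOf) : {c : ℕ // c ∈ D.crossings} := ⟨p.1.1, p.2⟩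

@[simp] theorem crossing_flip (p : D.PassOf) : D.crossing (D.flip p) = D.crossing p := rfl

/-- The coboundary on the dual graph: a function on the faces is sent to its jump across each edge,
from right to left. -/
noncomputable def faceDiff : (D.Face → ℚ) →ₗ[ℚ] (D.PassOf → ℚ) where
  toFun φ p := φ (D.face p 1) - φ (D.face (D.next p) (-1))
  map_add' φ ψ := by ext p; simp only [Pi.add_apply]; ring
  map_smul' a φ := by ext p; simp only [Pi.smul_apply, smul_eq_mul, RingHom.id_apply]; ring

/-- The coboundary on the graph: a function on the crossings is sent to its differences along the
edges. -/
noncomputable def crossingDiff : ({c : ℕ // c ∈ D.crossings} → ℚ) →ₗ[ℚ] (D.PassOf → ℚ) where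
  toFun f p := f (D.crossing p) - f (D.crossing (D.next p))
  map_add' φ ψ := by ext p; simp only [Pi.add_apply]; ring
  map_smul' a φ := by ext p; simp only [Pi.smul_apply, smul_eq_mul, RingHom.id_apply]; ring

theorem faceDiff_apply (φ : D.Face → ℚ) (p : D.PassOf) :
    D.faceDiff φ p = φ (D.face p 1) - φ (D.face (D.flip p) (-D.turn p.1)) := by
  rw [← face_next]; rfl

theorem faceDiff_symm_next (φ : D.Face → ℚ) (p : D.PassOf) :
    D.faceDiff φ (D.next.symm p) =
      φ (D.face (D.flip p) (D.turn p.1)) - φ (D.face p (-1)) := by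
  rw [← face_symm_next]
  simp [faceDiff]

/-- The passages of `D` are the crossings, each taken twice. -/
def passOfEquiv : D.PassOf ≃ {c : ℕ // c ∈ D.crossings} × Bool where
  toFun p := (D.crossing p, p.1.2)
  invFun x := ⟨(x.1.1, x.2), x.1.2⟩
  left_inv _ := rfl
  right_inv _ := rfl

instance : Fintype D.PassOf := Fintype.ofEquiv _ D.passOfEquiv.symm

theorem card_passOf : Fintype.card D.PassOf = 2 * D.crossings.card := by
  rw [Fintype.card_congr D.passOfEquiv, Fintype.card_prod, Fintype.card_coe, Fintype.card_bool,
    mul_comm]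

instance : Finite D.Face := by
  refine Finite.of_surjective (fun x : D.PassOf × ℤˣ => D.face x.1 x.2) ?_
  rintro ⟨⟨⟨p, ε⟩, h⟩⟩
  exact ⟨(⟨p, h⟩, ε), rfl⟩

instance : Finite D.Piece := Finite.of_surjective (Quot.mk _) Quot.mk_surjective

theorem sum_mul_crossingDiff (ψ : D.PassOf → ℚ) (f : {c : ℕ // c ∈ D.crossings} → ℚ) :
    ∑ p, ψ p * D.crossingDiff f p = ∑ p, (ψ p - ψ (D.next.symm p)) * f (D.crossing p) := by
  have : ∑ p, ψ p * f (D.crossing (D.next p)) = ∑ p, ψ (D.next.symm p) * f (D.crossing p) := by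
    rw [← Equiv.sum_comp D.next (fun p => ψ (D.next.symm p) * f (D.crossing p))]
    simp
  simp only [sub_mul, Finset.sum_sub_distrib, ← this]
  rw [← Finset.sum_sub_distrib]
  exact Finset.sum_congr rfl fun p _ => mul_sub _ _ _

theorem add_turn (g : ℤˣ → ℚ) (u : ℤˣ) : g u + g (-u) = g 1 + g (-1) := by
  rcases Int.units_eq_one_or u with rfl | rfl
  · rfl
  · rw [neg_neg, add_comm]

/-- The jumps of a function on the faces form a cycle: at each crossing, the difference of the jumps
along the outgoing and the incoming edge of one strand is opposite to that of the other strand. -/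
theorem sum_faceDiff_mul_crossingDiff (φ : D.Face → ℚ) (f : {c : ℕ // c ∈ D.crossings} → ℚ) :
    ∑ p, D.faceDiff φ p * D.crossingDiff f p = 0 := by
  rw [sum_mul_crossingDiff]
  let S (p : D.PassOf) : ℚ := φ (D.face p 1) + φ (D.face p (-1))
  have key : ∀ p, D.faceDiff φ p - D.faceDiff φ (D.next.symm p) = S p - S (D.flip p) := by
    intro p
    rw [faceDiff_apply, faceDiff_symm_next]
    have := add_turn (fun ε => φ (D.face (D.flip p) ε)) (D.turn p.1)
    simp only [S]
    linarith
  simp only [key, sub_mul, Finset.sum_sub_distrib]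
  rw [sub_eq_zero, ← Equiv.sum_comp D.flip (fun p => S (D.flip p) * f (D.crossing p))]
  simp

/-- A function on the crossings which is constant along the edges comes from the connected pieces. -/
theorem finrank_ker_crossingDiff_le :
    Module.finrank ℚ (LinearMap.ker D.crossingDiff) ≤ Nat.card D.Piece := by
  have := Fintype.ofFinite D.Piece
  let P : (D.Piece → ℚ) →ₗ[ℚ] ({c : ℕ // c ∈ D.crossings} → ℚ) :=
    LinearMap.funLeft ℚ ℚ (Quot.mk D.Joined)
  have h : LinearMap.ker D.crossingDiff ≤ LinearMap.range P := by
    intro f hf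
    rw [LinearMap.mem_ker] at hf
    refine ⟨Quot.lift f ?_, rfl⟩
    rintro ⟨c, hc⟩ ⟨d, hd⟩ ⟨a, b, hab⟩
    have e := hab.eq_next hc
    have h0 := congrFun hf ⟨(c, a), hc⟩
    simp only [crossingDiff, LinearMap.coe_mk, AddHom.coe_mk, Pi.zero_apply] at h0
    rw [sub_eq_zero] at h0
    refine h0.trans (congrArg f (Subtype.ext ?_))
    exact (congrArg Prod.fst e).symm
  refine (Submodule.finrank_mono h).trans ((LinearMap.finrank_range_le P).trans ?_)
  rw [Module.finrank_fintype_fun_eq_card, Nat.card_eq_fintype_card]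

/-- A function on the faces which does not jump across any edge takes a single value at each
crossing. -/
theorem face_eq_of_faceDiff_eq_zero {φ : D.Face → ℚ} (h : D.faceDiff φ = 0) (p : D.PassOf) :
    φ (D.face p 1) = φ (D.face p (-1)) ∧ φ (D.face (D.flip p) 1) = φ (D.face p 1) := by
  have h1 := congrFun h p
  have h2 := congrFun h (D.next.symm p)
  have h3 := congrFun h (D.flip p)
  have h4 := congrFun h (D.next.symm (D.flip p))
  rw [faceDiff_apply] at h1 h3
  rw [faceDiff_symm_next] at h2 h4
  rw [turn_flip, flip_flip] at h3 h4
  simp only [Pi.zero_apply, sub_eq_zero] at h1 h2 h3 h4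
  rcases Int.units_eq_one_or (D.turn p.1) with e | e <;>
    simp only [e, neg_neg] at h1 h2 h3 h4 <;>
    constructor <;> linarith

/-- A function on the faces without jumps comes from a function on the crossings which is constant
along the edges. -/
theorem finrank_ker_faceDiff_le :
    Module.finrank ℚ (LinearMap.ker D.faceDiff) ≤ Nat.card D.Piece := by
  let R : (D.Face → ℚ) →ₗ[ℚ] ({c : ℕ // c ∈ D.crossings} → ℚ) :=
    LinearMap.funLeft ℚ ℚ fun c => D.face ⟨(c.1, true), c.2⟩ 1
  have hR : ∀ φ ∈ LinearMap.ker D.faceDiff, ∀ p : D.PassOf, R φ (D.crossing p) = φ (D.face p 1) := by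
    intro φ hφ p
    obtain ⟨⟨c, b⟩, hp⟩ := p
    cases b
    · exact (D.face_eq_of_faceDiff_eq_zero hφ ⟨(c, false), hp⟩).2
    · rfl
  have h : ∀ φ ∈ LinearMap.ker D.faceDiff, R φ ∈ LinearMap.ker D.crossingDiff := by
    intro φ hφ
    rw [LinearMap.mem_ker]
    ext p
    change R φ (D.crossing p) - R φ (D.crossing (D.next p)) = 0
    rw [hR φ hφ, hR φ hφ, (D.face_eq_of_faceDiff_eq_zero hφ (D.next p)).1]
    exact congrFun hφ p
  have := Fintype.ofFinite D.Face
  refine (LinearMap.finrank_le_finrank_of_injective (f := R.restrict h) ?_).trans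
    D.finrank_ker_crossingDiff_le
  rw [← LinearMap.ker_eq_bot, LinearMap.ker_eq_bot']
  rintro ⟨φ, hφ⟩ h0
  have h0' : R φ = 0 := congrArg Subtype.val h0
  apply Subtype.ext
  have h1 : ∀ p, φ (D.face p 1) = 0 := fun p => by rw [← hR φ hφ, h0']; rfl
  ext x
  obtain ⟨⟨⟨p, ε⟩, hp⟩⟩ := x
  rcases Int.units_eq_one_or ε with rfl | rfl
  · exact h1 ⟨p, hp⟩
  · exact (D.face_eq_of_faceDiff_eq_zero hφ ⟨p, hp⟩).1.symm.trans (h1 ⟨p, hp⟩)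

variable {D}

/-- On a union of spheres, every cycle is a boundary: a function on the edges which is constant
along the components is the jump of a function on the faces. -/
theorem IsClassical.exists_faceDiff_eq (hD : D.IsClassical) {χ : D.PassOf → ℚ}
    (hχ : ∀ p, χ (D.next p) = χ p) : ∃ φ, D.faceDiff φ = χ := by
  have := Fintype.ofFinite D.Face
  have hinf : LinearMap.range D.faceDiff ⊓ LinearMap.range D.crossingDiff = ⊥ := by
    rw [eq_bot_iff]
    rintro ψ ⟨⟨φ, hφ⟩, ⟨f, hf⟩⟩
    have h := D.sum_faceDiff_mul_crossingDiff φ f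
    rw [hφ, hf] at h
    ext p
    exact mul_self_eq_zero.1
      ((Finset.sum_eq_zero_iff_of_nonneg fun p _ => mul_self_nonneg (ψ p)).1 h p (Finset.mem_univ p))
  have hsup : LinearMap.range D.faceDiff ⊔ LinearMap.range D.crossingDiff = ⊤ := by
    apply Submodule.eq_top_of_finrank_eq
    have h1 := Submodule.finrank_sup_add_finrank_inf_eq (LinearMap.range D.faceDiff)
      (LinearMap.range D.crossingDiff)
    have h2 := LinearMap.finrank_range_add_finrank_ker D.faceDiff
    have h3 := LinearMap.finrank_range_add_finrank_ker D.crossingDiff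
    have h4 := D.finrank_ker_faceDiff_le
    have h5 := D.finrank_ker_crossingDiff_le
    -- By Euler's formula, the lower bounds for the two ranks add up to the number of edges.
    have h6 := Submodule.finrank_le (LinearMap.range D.faceDiff ⊔ LinearMap.range D.crossingDiff)
    have h7 := D.card_passOf
    have h8 := hD
    unfold IsClassical at h8
    rw [hinf, finrank_bot] at h1
    rw [Module.finrank_fintype_fun_eq_card] at h2 h3 h6 ⊢
    rw [Fintype.card_coe] at h3
    rw [Nat.card_eq_fintype_card (α := D.Face)] at h8
    omega
  have hmem : χ ∈ LinearMap.range D.faceDiff ⊔ LinearMap.range D.crossingDiff := by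
    rw [hsup]; exact Submodule.mem_top
  -- The part of `χ` in the range of `crossingDiff` is orthogonal to itself.
  obtain ⟨-, ⟨φ, rfl⟩, -, ⟨f, rfl⟩, h⟩ := Submodule.mem_sup.1 hmem
  refine ⟨φ, ?_⟩
  have h0 : ∑ p, D.crossingDiff f p * D.crossingDiff f p = 0 := by
    have h1 := D.sum_mul_crossingDiff χ f
    have h2 : ∀ p, χ p - χ (D.next.symm p) = 0 := fun p => by
      rw [sub_eq_zero, ← hχ (D.next.symm p), Equiv.apply_symm_apply]
    simp only [h2, zero_mul, Finset.sum_const_zero] at h1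
    rw [← h] at h1
    simpa [add_mul, Finset.sum_add_distrib, D.sum_faceDiff_mul_crossingDiff φ f] using h1
  rw [← h]
  ext p
  have := mul_self_eq_zero.1 ((Finset.sum_eq_zero_iff_of_nonneg
    fun p _ => mul_self_nonneg (D.crossingDiff f p)).1 h0 p (Finset.mem_univ p))
  simp [this]

theorem sum_passOf (g : Pass → ℚ) :
    ∑ p : D.PassOf, g p.1 = ∑ c ∈ D.crossings, (g (c, true) + g (c, false)) := by
  rw [← Equiv.sum_comp D.passOfEquiv.symm (fun p => g p.1), Fintype.sum_prod_type,
    ← Finset.sum_coe_sort D.crossings fun c => g (c, true) + g (c, false)]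
  exact Finset.sum_congr rfl fun c _ => Fintype.sum_bool _

/-- In a classical diagram, each component crosses each other one as often over as under, counted
with signs. The component `j` is the jump of a function `φ` on the faces; someone walking along the
component `i` observes the value of `φ` on the left change by a sign at each crossing with `j`, and
these changes add up to zero. -/
theorem IsClassical.vlk_comm (hD : D.IsClassical) {i j : Fin n} (hij : i ≠ j) :
    D.vlk i j = D.vlk j i := by
  classical
  let χ (k : Fin n) (p : Pass) : ℚ := if p ∈ D.strand k then 1 else 0
  have hχ : ∀ k (p : D.PassOf), χ k (D.next p).1 = χ k p.1 := by
    intro k p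
    simp only [χ, D.next_mem_iff]
  have hχ' : ∀ k (p : D.PassOf), χ k (D.next.symm p).1 = χ k p.1 := by
    intro k p
    rw [← hχ k (D.next.symm p), Equiv.apply_symm_apply]
  obtain ⟨φ, hφ⟩ := hD.exists_faceDiff_eq (χ := fun p => χ j p.1) (hχ j)
  have key : ∀ p : D.PassOf, χ i p.1 * (φ (D.face p 1) - φ (D.face (D.next.symm p) 1)) =
      - (χ i p.1 * χ j p.1.flip * ((D.turn p.1 : ℤ) : ℚ)) := by
    intro p
    by_cases hp : p.1 ∈ D.strand i
    · have hj : χ j p.1 = 0 := if_neg fun h => hij (strand_unique hp h)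
      have h1 := congrFun hφ (D.next.symm p)
      have h2 := congrFun hφ (D.flip p)
      have h3 := congrFun hφ (D.next.symm (D.flip p))
      have h4 := congrFun hφ p
      rw [faceDiff_apply] at h2 h4
      rw [faceDiff_symm_next] at h1 h3
      rw [hχ', hj] at h1
      rw [hj] at h4
      rw [hχ'] at h3
      rw [turn_flip, flip_flip] at h2 h3
      have h5 : χ j (D.flip p).1 = χ j p.1.flip := rfl
      rw [h5] at h2 h3
      rw [face_symm_next]
      rcases Int.units_eq_one_or (D.turn p.1) with e | e <;>
        simp only [e, neg_neg] at h1 h2 h3 h4 ⊢ <;> push_cast <;>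
        simp only [mul_assoc, ← mul_neg] <;> congr 1 <;> linarith
    · simp [χ, hp]
  have hsum : ∑ p : D.PassOf, χ i p.1 * (φ (D.face p 1) - φ (D.face (D.next.symm p) 1)) = 0 := by
    simp only [mul_sub, Finset.sum_sub_distrib]
    rw [sub_eq_zero, ← Equiv.sum_comp D.next (fun p => χ i p.1 * φ (D.face (D.next.symm p) 1))]
    simp [hχ]
  simp only [key, Finset.sum_neg_distrib, neg_eq_zero] at hsum
  rw [D.sum_passOf fun p => χ i p * χ j p.flip * ((D.turn p : ℤ) : ℚ)] at hsum
  have e1 : ∀ k l, ((D.vlk k l : ℤ) : ℚ) =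
      ∑ c ∈ D.crossings, χ k (c, true) * χ l (c, false) * ((D.sign c : ℤ) : ℚ) := by
    intro k l
    unfold vlk
    rw [Finset.sum_filter]
    push_cast
    refine Finset.sum_congr rfl fun c _ => ?_
    simp only [χ]
    split_ifs <;> simp_all
  have : ((D.vlk i j : ℤ) : ℚ) - D.vlk j i = 0 := by
    rw [e1, e1, ← hsum, ← Finset.sum_sub_distrib]
    refine Finset.sum_congr rfl fun c _ => ?_
    simp [turn, Pass.flip]
    ring
  exact_mod_cast sub_eq_zero.1 this

end Planar

end GaussDiagram

/-! ### Closures of pure braids -/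

namespace BraidWord

theorem trace_cons (i : ℕ) (e : Bool) (w : BraidWord) (t p : ℕ) :
    trace ((i, e) :: w) t p =
      (if p = i then [(t, e)] else if p = i + 1 then [(t, !e)] else []) ++
        trace w (t + 1) (Equiv.swap i (i + 1) p) := by
  rw [trace]
  split_ifs with h1 h2
  · subst h1; simp
  · subst h2; simp
  · rw [Equiv.swap_apply_of_ne_of_ne h1 h2]; rfl

theorem endpoint_cons (i : ℕ) (e : Bool) (w : BraidWord) (p : ℕ) :
    endpoint ((i, e) :: w) p = endpoint w (Equiv.swap i (i + 1) p) := by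
  rw [endpoint]
  split_ifs with h1 h2
  · subst h1; simp
  · subst h2; simp
  · rw [Equiv.swap_apply_of_ne_of_ne h1 h2]

theorem endpoint_append (w w' : BraidWord) (p : ℕ) :
    endpoint (w ++ w') p = endpoint w' (endpoint w p) := by
  induction w generalizing p with
  | nil => rfl
  | cons x w ih => rw [List.cons_append, endpoint_cons, endpoint_cons, ih]

theorem endpoint_injective (w : BraidWord) : Function.Injective (endpoint w) := by
  induction w with
  | nil => exact fun _ _ h => h
  | cons x w ih =>
    intro a b h
    rw [endpoint_cons, endpoint_cons] at h
    exact (Equiv.swap _ _).injective (ih h)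

/-- The sum of the signs of the crossings of the braid at which the strand starting in position `a`
passes over the one starting in position `b`. -/
def overSum : BraidWord → ℕ → ℕ → ℤ
  | [], _, _ => 0
  | (i, true) :: w, a, b =>
    (if a = i ∧ b = i + 1 then 1 else 0) + overSum w (Equiv.swap i (i + 1) a) (Equiv.swap i (i + 1) b)
  | (i, false) :: w, a, b =>
    (if a = i + 1 ∧ b = i then -1 else 0) + overSum w (Equiv.swap i (i + 1) a) (Equiv.swap i (i + 1) b)

theorem overSum_cons (x : ℕ × Bool) (w : BraidWord) (a b : ℕ) :
    overSum (x :: w) a b = overSum [x] a b +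
      overSum w (Equiv.swap x.1 (x.1 + 1) a) (Equiv.swap x.1 (x.1 + 1) b) := by
  obtain ⟨i, e⟩ := x
  cases e <;> simp [overSum]

theorem overSum_append (w w' : BraidWord) (a b : ℕ) :
    overSum (w ++ w') a b = overSum w a b + overSum w' (endpoint w a) (endpoint w b) := by
  induction w generalizing a b with
  | nil => simp [overSum, endpoint]
  | cons x w ih =>
    rw [List.cons_append, overSum_cons, ih, overSum_cons x w, endpoint_cons, endpoint_cons]
    ring

theorem inv_cons (i : ℕ) (e : Bool) (w : BraidWord) : inv ((i, e) :: w) = inv w ++ [(i, !e)] := by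
  simp [inv]

theorem endpoint_inv (w : BraidWord) (p : ℕ) : endpoint (inv w) (endpoint w p) = p := by
  induction w generalizing p with
  | nil => rfl
  | cons x w ih =>
    rw [inv_cons, endpoint_append, endpoint_cons x.1 x.2, ih, endpoint_cons, Equiv.swap_apply_self]
    rfl

/-- The inverse letter has the two strands in the other positions, the same one on top, and the
opposite sign. -/
theorem overSum_singleton_not (i : ℕ) (e : Bool) (a b : ℕ) :
    overSum [(i, !e)] (Equiv.swap i (i + 1) a) (Equiv.swap i (i + 1) b) = - overSum [(i, e)] a b := by
  have h1 : ∀ p, Equiv.swap i (i + 1) p = i ↔ p = i + 1 := fun p => by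
    rw [Equiv.swap_apply_eq_iff, Equiv.swap_apply_left]
  have h2 : ∀ p, Equiv.swap i (i + 1) p = i + 1 ↔ p = i := fun p => by
    rw [Equiv.swap_apply_eq_iff, Equiv.swap_apply_right]
  cases e <;> simp only [overSum, Bool.not_true, Bool.not_false, h1, h2] <;> split_ifs <;> rfl

theorem overSum_inv (w : BraidWord) (a b : ℕ) :
    overSum (inv w) (endpoint w a) (endpoint w b) = - overSum w a b := by
  induction w generalizing a b with
  | nil => rfl
  | cons x w ih =>
    obtain ⟨i, e⟩ := x
    rw [inv_cons, overSum_append, endpoint_cons, endpoint_cons, ih, endpoint_inv, endpoint_inv,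
      overSum_cons _ w, overSum_singleton_not]
    ring

/-- Every strand ends where it starts. -/
def IsPure (w : BraidWord) : Prop := ∀ p, endpoint w p = p

theorem IsPure.append {w w' : BraidWord} (h : IsPure w) (h' : IsPure w') : IsPure (w ++ w') :=
  fun p => by rw [endpoint_append, h, h']

theorem IsPure.inv {w : BraidWord} (h : IsPure w) : IsPure (inv w) := fun p => by
  have := endpoint_inv w p
  rwa [h] at this

theorem IsPure.flatMap {α : Type*} {g : α → BraidWord} {l : List α} (h : ∀ x ∈ l, IsPure (g x)) :
    IsPure (l.flatMap g) := by
  induction l with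
  | nil => exact fun _ => rfl
  | cons x l ih =>
    rw [List.flatMap_cons]
    exact (h x (by simp)).append (ih fun y hy => h y (by simp [hy]))

theorem overSum_flatMap {α : Type*} {g : α → BraidWord} {l : List α} (h : ∀ x ∈ l, IsPure (g x))
    (a b : ℕ) : overSum (l.flatMap g) a b = (l.map fun x => overSum (g x) a b).sum := by
  induction l with
  | nil => rfl
  | cons x l ih =>
    rw [List.flatMap_cons, overSum_append, h x (by simp), h x (by simp),
      ih fun y hy => h y (by simp [hy])]
    rfl

theorem isPure_replicate {w : BraidWord} (h : IsPure w) (m : ℕ) :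
    IsPure (List.replicate m w).flatten := by
  induction m with
  | zero => exact fun _ => rfl
  | succ m ih => rw [List.replicate_succ, List.flatten_cons]; exact h.append ih

theorem overSum_replicate {w : BraidWord} (h : IsPure w) (m : ℕ) (a b : ℕ) :
    overSum (List.replicate m w).flatten a b = m * overSum w a b := by
  induction m with
  | zero => simp [overSum]
  | succ m ih =>
    rw [List.replicate_succ, List.flatten_cons, overSum_append, h, h, ih]
    push_cast; ring

theorem IsPure.pow {w : BraidWord} (h : IsPure w) (m : ℤ) : IsPure (pow w m) := by
  unfold BraidWord.pow
  split_ifs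
  · exact isPure_replicate h _
  · exact isPure_replicate h.inv _

theorem overSum_pow {w : BraidWord} (h : IsPure w) (m : ℤ) (a b : ℕ) :
    overSum (pow w m) a b = m * overSum w a b := by
  unfold BraidWord.pow
  split_ifs with hm
  · rw [overSum_replicate h, Int.natCast_natAbs, abs_of_nonneg hm]
  · have := overSum_inv w a b
    rw [h, h] at this
    rw [overSum_replicate h.inv, this, Int.natCast_natAbs, abs_of_neg (not_le.1 hm)]
    ring

theorem descending_succ {i j : ℕ} (h : i < j) :
    descending i (j + 1) = (j, true) :: descending i j := by
  have e : j + 1 - 1 - i = (j - 1 - i) + 1 := by omega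
  have e' : i + 1 + (j - 1 - i) = j := by omega
  rw [descending, e, List.range'_1_concat, e', List.map_append, List.reverse_append]
  rfl

theorem endpoint_descending {i j : ℕ} (h : i < j) :
    endpoint (descending i j) i = i ∧ endpoint (descending i j) j = i + 1 := by
  induction j, h using Nat.le_induction with
  | base => simp [descending, endpoint]
  | succ j h ih =>
    rw [descending_succ h, endpoint_cons, endpoint_cons, Equiv.swap_apply_right,
      Equiv.swap_apply_of_ne_of_ne (by omega) (by omega)]
    exact ih

theorem endpoint_twist (i p : ℕ) : endpoint [(i, true), (i, true)] p = p := by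
  rw [endpoint_cons, endpoint_cons, Equiv.swap_apply_self]
  rfl

theorem isPure_pureGen (i j : ℕ) : IsPure (pureGen i j) := fun p => by
  rw [pureGen, endpoint_append, endpoint_append, endpoint_twist, endpoint_inv]

/-- The word `A_{i,j}` lets the strands `i` and `j` cross positively twice, each being once on top;
the contributions of the two outer parts cancel. -/
theorem overSum_pureGen {i j : ℕ} (h : i < j) (a b : ℕ) :
    overSum (pureGen i j) a b =
      (if a = i ∧ b = j then 1 else 0) + (if a = j ∧ b = i then 1 else 0) := by
  obtain ⟨hi, hj⟩ := endpoint_descending h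
  have h1 : ∀ p, endpoint (descending i j) p = i ↔ p = i := fun p =>
    ⟨fun hp => endpoint_injective _ (hp.trans hi.symm), fun hp => hp ▸ hi⟩
  have h2 : ∀ p, endpoint (descending i j) p = i + 1 ↔ p = j := fun p =>
    ⟨fun hp => endpoint_injective _ (hp.trans hj.symm), fun hp => hp ▸ hj⟩
  have h3 : ∀ p, Equiv.swap i (i + 1) p = i ↔ p = i + 1 := fun p => by
    rw [Equiv.swap_apply_eq_iff, Equiv.swap_apply_left]
  have h4 : ∀ p, Equiv.swap i (i + 1) p = i + 1 ↔ p = i := fun p => by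
    rw [Equiv.swap_apply_eq_iff, Equiv.swap_apply_right]
  rw [pureGen, overSum_append, overSum_append, endpoint_append, endpoint_append, endpoint_twist,
    endpoint_twist, overSum_inv]
  simp only [overSum, h3, h4, h1, h2]
  ring

theorem mem_inv {w : BraidWord} {m : ℕ} {e : Bool} : (m, e) ∈ inv w ↔ (m, !e) ∈ w := by
  simp only [inv, List.mem_reverse, List.mem_map, Prod.mk.injEq, Prod.exists]
  constructor
  · rintro ⟨a, b, h, rfl, rfl⟩; simpa using h
  · exact fun h => ⟨m, !e, h, rfl, by simp⟩

theorem lt_of_mem_pureGen {i j : ℕ} (h : i < j) {x : ℕ × Bool} (hx : x ∈ pureGen i j) :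
    x.1 < j := by
  have hd : ∀ y ∈ descending i j, y.1 < j := by
    intro y hy
    simp only [descending, List.mem_reverse, List.mem_map, List.mem_range'_1] at hy
    obtain ⟨m, hm, rfl⟩ := hy
    simp only
    omega
  simp only [pureGen, List.mem_append, List.mem_cons, List.not_mem_nil, or_false] at hx
  rcases hx with (hx | rfl | rfl) | hx
  · exact hd x hx
  · exact h
  · exact h
  · exact hd (x.1, !x.2) (mem_inv.1 hx)

theorem lt_of_mem_pow {w : BraidWord} {j : ℕ} (h : ∀ x ∈ w, x.1 < j) (m : ℤ) {x : ℕ × Bool}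
    (hx : x ∈ pow w m) : x.1 < j := by
  simp only [BraidWord.pow, List.mem_flatten, List.mem_replicate] at hx
  obtain ⟨l, ⟨-, rfl⟩, hx⟩ := hx
  split_ifs at hx
  · exact h x hx
  · exact h (x.1, !x.2) (mem_inv.1 hx)

section Standard

variable {n : ℕ} (k : Fin n → Fin n → ℤ)

theorem isPure_factor (j : Fin n) : IsPure (factor k j) :=
  IsPure.flatMap fun i _ => (isPure_pureGen i j).pow _

theorem isPure_standard : IsPure (standard k) :=
  IsPure.flatMap fun j _ => isPure_factor k j

theorem lt_of_mem_standard {x : ℕ × Bool} (hx : x ∈ standard k) : x.1 + 1 < n := by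
  simp only [standard, factor, List.mem_flatMap, List.mem_filter, decide_eq_true_eq] at hx
  obtain ⟨j, -, i, ⟨-, hij⟩, hx⟩ := hx
  have := lt_of_mem_pow (fun y hy => lt_of_mem_pureGen hij hy) _ hx
  omega

theorem overSum_standard_eq_sum (a b : Fin n) : overSum (standard k) a b =
    ∑ j, ∑ i with i < j, k i j * ((if a = i ∧ b = j then 1 else 0) +
      (if a = j ∧ b = i then 1 else 0)) := by
  rw [standard, overSum_flatMap fun j _ => isPure_factor k j,
    ← List.sum_toFinset _ (List.nodup_finRange n), List.toFinset_finRange]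
  refine Finset.sum_congr rfl fun j _ => ?_
  rw [factor, overSum_flatMap fun (i : Fin n) _ => (isPure_pureGen i j).pow _,
    ← List.sum_toFinset _ ((List.nodup_finRange n).filter _), List.toFinset_filter,
    List.toFinset_finRange]
  refine Finset.sum_congr (by ext; simp) fun i hi => ?_
  have hij : i < j := by simpa using hi
  rw [overSum_pow (isPure_pureGen i j), overSum_pureGen hij]
  simp only [Fin.ext_iff]

theorem overSum_standard_comm (a b : Fin n) : overSum (standard k) a b = overSum (standard k) b a := by
  rw [overSum_standard_eq_sum, overSum_standard_eq_sum]
  refine Finset.sum_congr rfl fun j _ => Finset.sum_congr rfl fun i _ => ?_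
  rw [add_comm]
  simp only [and_comm]

/-- In the standard braid the strands `a < b` have ordered linking numbers `k a b`. -/
theorem overSum_standard {a b : Fin n} (h : a < b) : overSum (standard k) a b = k a b := by
  rw [overSum_standard_eq_sum, Finset.sum_eq_single b, Finset.sum_eq_single a]
  · simp [h.ne]
  · intro i _ hi
    simp [hi.symm, h.ne]
  · intro ha
    simp [h] at ha
  · intro j _ hj
    refine Finset.sum_eq_zero fun i hi => ?_
    have hij : i < j := by simpa using hi
    have h2 : ¬ (a = j ∧ b = i) := by
      rintro ⟨rfl, rfl⟩
      exact absurd h hij.asymm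
    simp [hj.symm, h2]
  · simp

end Standard

theorem le_of_mem_trace {w : BraidWord} {t p : ℕ} {x : Pass} (hx : x ∈ trace w t p) : t ≤ x.1 := by
  induction w generalizing t p with
  | nil => simp [trace] at hx
  | cons y w ih =>
    rw [trace_cons, List.mem_append] at hx
    rcases hx with hx | hx
    · split_ifs at hx <;> simp_all
    · exact (Nat.le_succ t).trans (ih hx)

/-- Each crossing of a braid word has one overpass and one underpass, shared out among the strands. -/
theorem sum_count_trace {n : ℕ} {w : BraidWord} (h : ∀ x ∈ w, x.1 + 1 < n) (t : ℕ) (x : Pass) :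
    ∑ p ∈ Finset.range n, (trace w t p).count x =
      if t ≤ x.1 ∧ x.1 < t + w.length then 1 else 0 := by
  induction w generalizing t with
  | nil =>
    rw [if_neg (by simp)]
    simp [trace]
  | cons y w ih =>
    obtain ⟨i, e⟩ := y
    have hi : i + 1 < n := h (i, e) (by simp)
    simp only [trace_cons, List.count_append, Finset.sum_add_distrib]
    have e1 : ∑ p ∈ Finset.range n, (trace w (t + 1) (Equiv.swap i (i + 1) p)).count x =
        ∑ p ∈ Finset.range n, (trace w (t + 1) p).count x := by
      refine Finset.sum_equiv (Equiv.swap i (i + 1)) (fun p => ?_) fun _ _ => rfl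
      simp only [Finset.mem_range]
      rcases eq_or_ne p i with rfl | h1
      · simp; omega
      · rcases eq_or_ne p (i + 1) with rfl | h2
        · simp; omega
        · rw [Equiv.swap_apply_of_ne_of_ne h1 h2]
    have e2 : ∀ p, List.count x (if p = i then [(t, e)] else if p = i + 1 then [(t, !e)] else []) =
        (if p = i then (if x = (t, e) then 1 else 0) else 0) +
        (if p = i + 1 then (if x = (t, !e) then 1 else 0) else 0) := by
      intro p
      have hii : ¬ i = i + 1 := by omega
      split_ifs <;> simp_all [eq_comm]
    rw [e1, ih (fun y hy => h y (by simp [hy]))]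
    simp only [e2, Finset.sum_add_distrib, Finset.sum_ite_eq', Finset.mem_range,
      hi, Nat.lt_of_succ_lt hi, if_true, List.length_cons]
    obtain ⟨c, b⟩ := x
    simp only [Prod.mk.injEq]
    by_cases hc : c = t
    · subst hc
      cases b <;> cases e <;> simp
    · simp only [hc, false_and, if_false, zero_add]
      congr 1
      apply propext
      omega

/-- The sign of the crossing number `t`; beyond the length of the word the value is irrelevant. -/
def signAt (w : BraidWord) (t : ℕ) : ℤˣ := if (w.getD t (0, true)).2 then 1 else -1

theorem sum_signAt_eq_overSum (w : BraidWord) (t a b : ℕ) :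
    ∑ c ∈ Finset.range w.length,
      (if (t + c, true) ∈ trace w t a ∧ (t + c, false) ∈ trace w t b then (signAt w c : ℤ) else 0) =
      overSum w a b := by
  induction w generalizing t a b with
  | nil => rfl
  | cons y w ih =>
    obtain ⟨i, e⟩ := y
    rw [List.length_cons, Finset.sum_range_succ', overSum_cons, ← ih (t + 1), add_comm]
    have hne : ∀ p b', ((t, b') : Pass) ∉ trace w (t + 1) p := fun p b' hm => by
      have := le_of_mem_trace hm
      simp at this
    congr 1
    · simp only [add_zero, trace_cons, List.mem_append, hne, or_false, signAt, List.getD_cons_zero]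
      have hii : ¬ i = i + 1 := by omega
      cases e <;> simp only [overSum, Bool.not_true, Bool.not_false] <;>
        by_cases h1 : a = i <;> by_cases h2 : a = i + 1 <;>
        by_cases h3 : b = i <;> by_cases h4 : b = i + 1 <;> simp_all
    · refine Finset.sum_congr rfl fun c _ => ?_
      have hm : ∀ p b', ((t + (c + 1), b') : Pass) ∈ trace ((i, e) :: w) t p ↔
          ((t + 1 + c, b') : Pass) ∈ trace w (t + 1) (Equiv.swap i (i + 1) p) := by
        intro p b'
        rw [trace_cons, List.mem_append, show t + (c + 1) = t + 1 + c by ring]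
        refine or_iff_right ?_
        split_ifs <;> simp <;> omega
      simp only [hm]
      rfl

end BraidWord

namespace GaussDiagram

variable {n : ℕ}

/-- The diagram of the closure of a braid word, with the crossings numbered in the order of the
word. -/
def closure (w : BraidWord) (h : ∀ x ∈ w, x.1 + 1 < n) : GaussDiagram n where
  crossings := Finset.range w.length
  strand i := w.trace 0 i
  sign := w.signAt
  count_eq x := by
    have h1 := BraidWord.sum_count_trace h 0 x
    rw [Finset.sum_range] at h1
    simpa using h1

theorem vlk_closure (w : BraidWord) (h : ∀ x ∈ w, x.1 + 1 < n) (i j : Fin n) :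
    (closure w h).vlk i j = w.overSum i j := by
  rw [← w.sum_signAt_eq_overSum 0, vlk, Finset.sum_filter]
  simp only [zero_add]
  rfl

theorem isPureBraidClosure_closure {w : BraidWord} (h : ∀ x ∈ w, x.1 + 1 < n) (hw : w.IsPure) :
    (closure w h).IsPureBraidClosure w := by
  refine ⟨h, fun i => hw i, fun i => rfl, fun t ht => ?_⟩
  change w.signAt t = _
  rw [BraidWord.signAt, List.getD_eq_getElem _ _ ht]

end GaussDiagram

/-! ### Linking numbers of classical diagrams -/

namespace GaussDiagram

variable {n : ℕ}

theorem IsClassical.lk_eq_vlk {D : GaussDiagram n} (hD : D.IsClassical) {i j : Fin n}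
    (hij : i ≠ j) : D.lk i j = D.vlk i j := by
  rw [D.lk_eq hij, hD.vlk_comm hij]
  ring

theorem IsClassical.vlk_eq_iff {D D' : GaussDiagram n} (hD : D.IsClassical)
    (hD' : D'.IsClassical) :
    (∀ i j, i ≠ j → D.vlk i j = D'.vlk i j) ↔ ∀ i j, i < j → D.lk i j = D'.lk i j := by
  constructor
  · intro h i j hij
    rw [hD.lk_eq_vlk hij.ne, hD'.lk_eq_vlk hij.ne, h i j hij.ne]
  · intro h i j hij
    rcases hij.lt_or_gt with hlt | hlt
    · have := h i j hlt
      rw [hD.lk_eq_vlk hij, hD'.lk_eq_vlk hij] at this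
      exact_mod_cast this
    · have := h j i hlt
      rw [hD.lk_eq_vlk hij.symm, hD'.lk_eq_vlk hij.symm] at this
      rw [hD.vlk_comm hij, hD'.vlk_comm hij]
      exact_mod_cast this

end GaussDiagram

theorem theorem2 (n : ℕ) :
    (∀ D D' : GaussDiagram n, D.IsClassical → D'.IsClassical →
      (D.FusedIsotopic D' ↔ ∀ i j : Fin n, i < j → D.lk i j = D'.lk i j)) ∧
    (∀ D : GaussDiagram n, D.IsClassical →
      ∃ k : Fin n → Fin n → ℤ, (∀ i j : Fin n, i < j → (k i j : ℚ) = D.lk i j) ∧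
        ∃ B : GaussDiagram n, B.IsPureBraidClosure (BraidWord.standard k) ∧
          D.FusedIsotopic B) := by
  refine ⟨fun D D' hD hD' => GaussDiagram.fusedIsotopic_iff_vlk.trans (hD.vlk_eq_iff hD'),
    fun D hD => ⟨fun i j => D.vlk i j, fun i j hij => (hD.lk_eq_vlk hij.ne).symm, ?_⟩⟩
  have hw : ∀ x ∈ BraidWord.standard fun i j => D.vlk i j, x.1 + 1 < n :=
    fun _ => BraidWord.lt_of_mem_standard _
  refine ⟨GaussDiagram.closure _ hw, GaussDiagram.isPureBraidClosure_closure hw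
    (BraidWord.isPure_standard _), GaussDiagram.fusedIsotopic_iff_vlk.2 fun i j hij => ?_⟩
  rw [GaussDiagram.vlk_closure]
  rcases hij.lt_or_gt with hlt | hlt
  · rw [BraidWord.overSum_standard _ hlt]
  · rw [BraidWord.overSum_standard_comm, BraidWord.overSum_standard _ hlt, hD.vlk_comm hij]
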